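/- Let $d\ge 4$ be an even integer and let $1\le p,r\le\infty$. For a finite field $\mathbb F_q$ of odd characteristic, endow $\mathbb F_q^d$ with the normalized counting measure $dx$ (each point has mass $q^{-d}$). Call a surface $S=\{x\in\mathbb F_q^d: a_1x_1^2+\dots+a_dx_d^2=0\}$ admissible if $a_1,\dots,a_d\in\mathbb F_q\setminus\{0\}$ and $S$ contains a $d/2$-dimensional linear subspace of $\mathbb F_q^d$. Let $d\sigma$ be the normalized surface measure on $S$, so that $f*d\sigma(x)=\frac1{|S|}\sum_{y\in S}f(x-y)$ for $f:\mathbb F_q^d\to\mathbb C$. Let $\Omega_d\subset\mathbb R^2$ be the convex hull of $$(0,0),\ (0,1),\ (1,1),\ \Big(\tfrac{d^2-2d+2}{d(d-1)},\tfrac1{d-1}\Big),\ \Big(\tfrac{d-2}{d-1},\tfrac{d-2}{d(d-1)}\Big).$$ (i) There is a constant $C=C(d,p,r)<\infty$ such that $$\|f*d\sigma\|_{L^r(\mathbb F_q^d,dx)}\le C\,\|f\|_{L^p(\mathbb F_q^d,dx)}$$ for all finite fields $\mathbb F_q$ of odd characteristic, all admissible $S\subset\mathbb F_q^d$ and all $f:\mathbb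 F_q^d\to\mathbb C$ if and only if $(1/p,1/r)\in\Omega_d$. (ii) More precisely, for any given family of pairs $(\mathbb F_{q_i},S_i)$, with $\mathbb F_{q_i}$ of odd characteristic, $S_i\subset\mathbb F_{q_i}^d$ admissible, and $\sup_i q_i=\infty$, the inequality holds with one constant for all members of the family and all $f$ if and only if $(1/p,1/r)\in\Omega_d$. -/

import Mathlib

open MeasureTheory
open scoped ENNReal NNReal

universe u v

noncomputable section

namespace QuadricAveraging

/-- The normalized counting measure `dx` on a finite set `X` (all subsets are measurable):
every point has mass `1 / |X|`. -/
def normalizedCount (X : Type*) [Fintype X] : @Measure X ⊤ :=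
  (Fintype.card X : ℝ≥0∞)⁻¹ • @Measure.count X ⊤

/-- The surface `{x ∈ F^d : a₁ x₁² + ⋯ + a_d x_d² = 0}`. -/
def quadric {d : ℕ} {F : Type*} [Field F] (a : Fin d → F) : Set (Fin d → F) :=
  {x | ∑ j, a j * x j ^ 2 = 0}

open Classical in
/-- The averaging operator `f ∗ dσ`, where `σ` is the normalized surface measure on `V`:
`(f ∗ dσ)(x) = |V|⁻¹ ∑_{y ∈ V} f (x - y)`. -/
def average {d : ℕ} {F : Type*} [Field F] [Fintype F] (V : Set (Fin d → F))
    (f : (Fin d → F) → ℂ) (x : Fin d → F) : ℂ :=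
  (V.ncard : ℂ)⁻¹ * ∑ y ∈ V.toFinset, f (x - y)

/-- The averaging operator over `V ⊆ F^d` maps `L^p(F^d, dx)` to `L^r(F^d, dx)` with norm at
most `C`. -/
def AveragingBound {d : ℕ} {F : Type*} [Field F] [Fintype F] (V : Set (Fin d → F))
    (p r : ℝ≥0∞) (C : ℝ≥0) : Prop :=
  ∀ f : (Fin d → F) → ℂ,
    eLpNorm (average V f) r (normalizedCount (Fin d → F)) ≤
      C * eLpNorm f p (normalizedCount (Fin d → F))

/-- The surfaces under consideration: `F` has odd characteristic, all the coefficients are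
nonzero, and the surface contains a linear subspace of dimension `d / 2`. -/
structure IsAdmissible {d : ℕ} {F : Type*} [Field F] (a : Fin d → F) : Prop where
  char_ne_two : ringChar F ≠ 2
  coeff_ne_zero : ∀ j, a j ≠ 0
  exists_subspace : ∃ H : Submodule F (Fin d → F),
    Module.finrank F H = d / 2 ∧ (H : Set (Fin d → F)) ⊆ quadric a

/-- The convex hull of the five vertices in the `(1/p, 1/r)`-plane. -/
def exponentRegion (d : ℕ) : Set (ℝ × ℝ) :=
  convexHull ℝ {((0 : ℝ), (0 : ℝ)), (0, 1), (1, 1),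
    (((d : ℝ) ^ 2 - 2 * d + 2) / (d * (d - 1)), 1 / ((d : ℝ) - 1)),
    (((d : ℝ) - 2) / (d - 1), ((d : ℝ) - 2) / (d * (d - 1)))}

end QuadricAveraging

end

/-! Write `d = 2k` and `q = |F|`. For sufficiency it is enough to treat the five vertices. The
averages are positive operators, so Hölder's inequality gives interpolation and the set of bounded
exponents is convex (`convex_boundedExponents`). Three vertices are trivial. The last two are
exchanged by duality, because the quadric is symmetric about the origin. What remains is the vertex
with `r = d - 1` (`exists_averagingBound_vertex`).

For a set `G`, expand the count of `G` in a translate of the quadric in additive characters and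
remove the zero frequency, which gives the expected count `|G|/q`. The remainder has squared `L²`
norm at most `q^d |G|` (`sum_sq_discrepancy_le`), and also at most `q^(d-1) |G| + q^k |G|²`
(`sum_sq_discrepancy_le'`). Together with the trivial sup bound `|G|`, these give two `L^r` bounds,
which exchange roles near `|G| = q^k`. For general `g`, cut into dyadic level sets. At the vertex
exponents the contributions decay geometrically, or rise geometrically until the crossover and decay
after it, and each piece is `O(q)`. The sum therefore loses no logarithm, and the endpoint holds in
strong form (`exists_sum_dyadic_le`).

For necessity, indicators of the quadric, of a point and of a `k`-dimensional subspace inside the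
quadric give three linear inequalities as `q → ∞`. These are the three lower edges of the pentagon
(`mem_exponentRegion_of_bounded`, `mem_exponentRegion`). -/

noncomputable section

namespace QuadricAveraging

/-! ### Exponential sums and `L²` bounds for the discrepancy. -/

section CharacterSums

variable {F : Type*} [Field F] {d : ℕ}

/-- The quadratic form `∑ a_j x_j ^ 2`. -/
def diagForm (a : Fin d → F) (x : Fin d → F) : F := ∑ j, a j * x j ^ 2

lemma mem_quadric {a x : Fin d → F} : x ∈ quadric a ↔ diagForm a x = 0 := Iff.rfl

lemma diagForm_neg (a x : Fin d → F) : diagForm a (-x) = diagForm a x := by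
  simp [diagForm]

lemma zero_mem_quadric (a : Fin d → F) : (0 : Fin d → F) ∈ quadric a := by
  simp [mem_quadric, diagForm]

variable [Fintype F]

lemma exists_addChar_ne_one (F : Type*) [Field F] [Fintype F] :
    ∃ ψ : AddChar F ℂ, ψ ≠ 1 := by
  obtain ⟨ψ, h⟩ := AddChar.exists_apply_ne_zero.2 (one_ne_zero : (1 : F) ≠ 0)
  exact ⟨ψ, fun h' => h (by simp [h'])⟩

lemma addChar_conj (ψ : AddChar F ℂ) (u : F) : (starRingEnd ℂ) (ψ u) = ψ (-u) :=
  (AddChar.map_neg_eq_conj ψ u).symm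

lemma sum_addChar_mul {ψ : AddChar F ℂ} (hψ : ψ ≠ 1) {u : F} (hu : u ≠ 0) :
    ∑ t, ψ (t * u) = 0 := by
  classical
  have := AddChar.sum_mulShift u (AddChar.IsPrimitive.of_ne_one hψ)
  simpa [hu] using this

/-- Orthogonality of the linear characters of `F ^ d`. -/
lemma sum_addChar_linear {ψ : AddChar F ℂ} (hψ : ψ ≠ 1) {c : Fin d → F} (hc : c ≠ 0) :
    ∑ x : Fin d → F, ψ (∑ j, c j * x j) = 0 := by
  classical
  obtain ⟨i, hi⟩ := Function.ne_iff.1 hc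
  have h1 : ∀ x : Fin d → F, ψ (∑ j, c j * x j) = ∏ j, ψ (c j * x j) := fun x => by
    induction (Finset.univ : Finset (Fin d)) using Finset.induction_on with
    | empty => simp
    | insert a s ha ih => rw [Finset.sum_insert ha, Finset.prod_insert ha, AddChar.map_add_eq_mul, ih]
  simp_rw [h1]
  rw [← Fintype.piFinset_univ, ← Finset.prod_univ_sum (fun _ => Finset.univ) (fun j u => ψ (c j * u))]
  refine Finset.prod_eq_zero (Finset.mem_univ i) ?_
  simp_rw [mul_comm (c i)]
  exact sum_addChar_mul hψ hi

/-- Quadratic exponential sums in `d` variables have square root cancellation. -/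
lemma norm_sum_addChar_quadratic (h2 : (2 : F) ≠ 0) {ψ : AddChar F ℂ} (hψ : ψ ≠ 1)
    {a : Fin d → F} (ha : ∀ j, a j ≠ 0) (b c : Fin d → F) :
    ‖∑ x : Fin d → F, ψ (∑ j, (a j * x j ^ 2 + b j * x j + c j))‖ ^ 2
      = (Fintype.card F : ℝ) ^ d := by
  classical
  set P : (Fin d → F) → F := fun x => ∑ j, (a j * x j ^ 2 + b j * x j + c j) with hP
  have key : (∑ x, ψ (P x)) * (starRingEnd ℂ) (∑ x, ψ (P x)) = (Fintype.card F : ℂ) ^ d := by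
    rw [map_sum, Finset.sum_mul_sum, Finset.sum_comm]
    -- Weyl differencing: with `x = y + h` the phase difference is linear in `y`, so only `h = 0`
    -- survives the sum over `y`.
    have h1 : ∀ y, ∑ x, ψ (P x) * (starRingEnd ℂ) (ψ (P y)) =
        ∑ h : Fin d → F, ψ (∑ j, (2 * a j * h j) * y j) * ψ (∑ j, (a j * h j ^ 2 + b j * h j)) := by
      intro y
      rw [← Equiv.sum_comp (Equiv.addRight y)]
      refine Finset.sum_congr rfl fun h _ => ?_
      rw [addChar_conj, ← AddChar.map_add_eq_mul, ← AddChar.map_add_eq_mul, hP]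
      simp only [Equiv.coe_addRight, Pi.add_apply]
      rw [← sub_eq_add_neg, ← Finset.sum_sub_distrib, ← Finset.sum_add_distrib]
      congr 1
      exact Finset.sum_congr rfl fun j _ => by ring
    simp_rw [h1]
    rw [Finset.sum_comm]
    simp_rw [← Finset.sum_mul]
    rw [Finset.sum_eq_single 0]
    · simp
    · intro h _ hh
      rw [sum_addChar_linear hψ, zero_mul]
      obtain ⟨i, hi⟩ := Function.ne_iff.1 hh
      exact Function.ne_iff.2 ⟨i, by simpa [h2, ha i] using hi⟩
    · simp
  rw [Complex.mul_conj, Complex.normSq_eq_norm_sq] at key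
  exact_mod_cast key

variable (a : Fin d → F)

/-- At equal frequencies the quadratic terms in `x` cancel and a nontrivial linear character
remains. -/
lemma sum_addChar_kernel_self (h2 : (2 : F) ≠ 0) {ψ : AddChar F ℂ} (hψ : ψ ≠ 1)
    (ha : ∀ j, a j ≠ 0) {t : F} (ht : t ≠ 0) {y z : Fin d → F} (hyz : y ≠ z) :
    ∑ x, ψ (t * diagForm a (x - y) - t * diagForm a (x - z)) = 0 := by
  have : ∀ x, ψ (t * diagForm a (x - y) - t * diagForm a (x - z)) =
      ψ (∑ j, (2 * t * a j * (z j - y j)) * x j) * ψ (∑ j, t * a j * (y j ^ 2 - z j ^ 2)) := by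
    intro x
    rw [← AddChar.map_add_eq_mul, diagForm, diagForm, Finset.mul_sum, Finset.mul_sum,
      ← Finset.sum_sub_distrib, ← Finset.sum_add_distrib]
    congr 1
    exact Finset.sum_congr rfl fun j _ => by simp only [Pi.sub_apply]; ring
  simp_rw [this]
  rw [← Finset.sum_mul, sum_addChar_linear hψ, zero_mul]
  obtain ⟨i, hi⟩ := Function.ne_iff.1 hyz
  exact Function.ne_iff.2 ⟨i, by simp [h2, ha i, ht, sub_eq_zero, Ne.symm hi]⟩

/-- At distinct frequencies the quadratic part is `(s - t)` times the form, still nondegenerate. -/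
lemma norm_sum_addChar_kernel (h2 : (2 : F) ≠ 0) {ψ : AddChar F ℂ} (hψ : ψ ≠ 1)
    (ha : ∀ j, a j ≠ 0) {s t : F} (hst : s ≠ t) (y z : Fin d → F) :
    ‖∑ x, ψ (s * diagForm a (x - y) - t * diagForm a (x - z))‖ ^ 2
      = (Fintype.card F : ℝ) ^ d := by
  rw [← norm_sum_addChar_quadratic h2 hψ (a := fun j => (s - t) * a j)
    (fun j => mul_ne_zero (sub_ne_zero.2 hst) (ha j))
    (fun j => 2 * a j * (t * z j - s * y j)) (fun j => a j * (s * y j ^ 2 - t * z j ^ 2))]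
  congr 2
  refine Finset.sum_congr rfl fun x _ => ?_
  rw [diagForm, diagForm, Finset.mul_sum, Finset.mul_sum, ← Finset.sum_sub_distrib]
  congr 1
  exact Finset.sum_congr rfl fun j _ => by simp only [Pi.sub_apply]; ring

/-- The modulated sums `∑_{y ∈ G} ψ(t Q(x - y))`. -/
def phaseSum (ψ : AddChar F ℂ) (G : Finset (Fin d → F)) (t : F) (x : Fin d → F) : ℂ :=
  ∑ y ∈ G, ψ (t * diagForm a (x - y))

lemma sum_phaseSum_mul_conj (ψ : AddChar F ℂ) (G : Finset (Fin d → F)) (s t : F) :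
    ∑ x, phaseSum a ψ G s x * (starRingEnd ℂ) (phaseSum a ψ G t x) =
      ∑ y ∈ G, ∑ z ∈ G, ∑ x, ψ (s * diagForm a (x - y) - t * diagForm a (x - z)) := by
  simp_rw [phaseSum, map_sum, Finset.sum_mul_sum]
  rw [Finset.sum_comm]
  refine Finset.sum_congr rfl fun y _ => ?_
  rw [Finset.sum_comm]
  refine Finset.sum_congr rfl fun z _ => Finset.sum_congr rfl fun x _ => ?_
  rw [addChar_conj, ← AddChar.map_add_eq_mul, ← sub_eq_add_neg]

lemma sum_phaseSum_self (h2 : (2 : F) ≠ 0) {ψ : AddChar F ℂ} (hψ : ψ ≠ 1)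
    (ha : ∀ j, a j ≠ 0) (G : Finset (Fin d → F)) {t : F} (ht : t ≠ 0) :
    ∑ x, phaseSum a ψ G t x * (starRingEnd ℂ) (phaseSum a ψ G t x) =
      (Fintype.card F : ℂ) ^ d * G.card := by
  classical
  rw [sum_phaseSum_mul_conj]
  have : ∀ y ∈ G, ∑ z ∈ G, ∑ x, ψ (t * diagForm a (x - y) - t * diagForm a (x - z)) =
      (Fintype.card F : ℂ) ^ d := by
    intro y hy
    rw [Finset.sum_eq_single_of_mem y hy]
    · simp
    · intro z _ hz
      exact sum_addChar_kernel_self a h2 hψ ha ht hz.symm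
  rw [Finset.sum_congr rfl this]
  simp [mul_comm]

lemma norm_sum_phaseSum_le (h2 : (2 : F) ≠ 0) {ψ : AddChar F ℂ} (hψ : ψ ≠ 1)
    (ha : ∀ j, a j ≠ 0) {k : ℕ} (hk : d = k + k) (G : Finset (Fin d → F)) {s t : F}
    (hst : s ≠ t) :
    ‖∑ x, phaseSum a ψ G s x * (starRingEnd ℂ) (phaseSum a ψ G t x)‖ ≤
      (Fintype.card F : ℝ) ^ k * (G.card : ℝ) ^ 2 := by
  rw [sum_phaseSum_mul_conj]
  have h : ∀ y z, ‖∑ x, ψ (s * diagForm a (x - y) - t * diagForm a (x - z))‖ ≤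
      (Fintype.card F : ℝ) ^ k := by
    intro y z
    refine le_of_sq_le_sq ?_ (by positivity)
    rw [norm_sum_addChar_kernel a h2 hψ ha hst, hk, pow_add, sq]
  calc _ ≤ ∑ y ∈ G, ∑ z ∈ G, (Fintype.card F : ℝ) ^ k :=
        (norm_sum_le _ _).trans (Finset.sum_le_sum fun y _ =>
          (norm_sum_le _ _).trans (Finset.sum_le_sum fun z _ => h y z))
    _ = _ := by simp; ring

open Classical in
/-- The number of points of `G` in the translate `x - V`, minus its expected value. -/
def discrepancy (G : Finset (Fin d → F)) (x : Fin d → F) : ℝ :=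
  ((G.filter fun y => x - y ∈ quadric a).card : ℝ) - G.card / Fintype.card F

/-- The sum of `ψ (t * u)` over all `t` detects `u = 0`; the term `t = 0` is exactly the expected
value that the discrepancy subtracts. -/
lemma card_mul_discrepancy [DecidableEq F] {ψ : AddChar F ℂ} (hψ : ψ ≠ 1) (G : Finset (Fin d → F))
    (x : Fin d → F) : (discrepancy a G x : ℂ) * Fintype.card F =
      ∑ t ∈ Finset.univ.erase (0 : F), phaseSum a ψ G t x := by
  classical
  have hq : (Fintype.card F : ℂ) ≠ 0 := by simp
  have h1 : ∑ t, phaseSum a ψ G t x =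
      (G.filter fun y => x - y ∈ quadric a).card * (Fintype.card F : ℂ) := by
    simp_rw [phaseSum]
    rw [Finset.sum_comm, Finset.card_filter, Nat.cast_sum, Finset.sum_mul]
    refine Finset.sum_congr rfl fun y _ => ?_
    rw [mem_quadric]
    split_ifs with h
    · simp [h]
    · rw [sum_addChar_mul hψ h]; simp
  have h2 : ∑ t, phaseSum a ψ G t x = phaseSum a ψ G 0 x +
      ∑ t ∈ Finset.univ.erase (0 : F), phaseSum a ψ G t x := by
    rw [← Finset.add_sum_erase _ _ (Finset.mem_univ (0 : F))]
  have h3 : phaseSum a ψ G 0 x = G.card := by simp [phaseSum]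
  rw [h1, h3] at h2
  rw [discrepancy]
  push_cast
  rw [sub_mul, h2]
  field_simp
  ring

lemma abs_discrepancy_le (G : Finset (Fin d → F)) (x : Fin d → F) :
    |discrepancy a G x| ≤ G.card := by
  classical
  have hq : (1 : ℝ) ≤ Fintype.card F := by exact_mod_cast Fintype.card_pos
  have h1 : ((G.filter fun y => x - y ∈ quadric a).card : ℝ) ≤ G.card := by
    exact_mod_cast Finset.card_filter_le _ _
  have h2 : (G.card : ℝ) / Fintype.card F ≤ G.card := div_le_self (by positivity) hq
  have h3 : (0 : ℝ) ≤ (G.card : ℝ) / Fintype.card F := by positivity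
  have h4 : (0 : ℝ) ≤ ((G.filter fun y => x - y ∈ quadric a).card : ℝ) := by positivity
  rw [discrepancy, abs_le]
  constructor <;> linarith

/-- The operator `T - J / q` has norm at most `q ^ (d / 2)` on `L ^ 2`. -/
lemma sum_sq_discrepancy_le (h2 : (2 : F) ≠ 0) (ha : ∀ j, a j ≠ 0) (G : Finset (Fin d → F)) :
    ∑ x, discrepancy a G x ^ 2 ≤ (Fintype.card F : ℝ) ^ d * G.card := by
  classical
  obtain ⟨ψ, hψ⟩ := exists_addChar_ne_one F
  set q : ℝ := (Fintype.card F : ℝ) with hqdef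
  have hq : 0 < q := by rw [hqdef]; exact_mod_cast Fintype.card_pos
  set s := Finset.univ.erase (0 : F) with hs
  have hcard : (s.card : ℝ) ≤ q := by
    rw [hqdef]; exact_mod_cast Finset.card_le_univ s
  -- Cauchy–Schwarz over the nonzero frequencies, so that only equal-frequency correlations are
  -- needed.
  have h1 : ∀ x, discrepancy a G x ^ 2 * q ^ 2 ≤ q * ∑ t ∈ s, ‖phaseSum a ψ G t x‖ ^ 2 := by
    intro x
    have e : |discrepancy a G x| * q = ‖∑ t ∈ s, phaseSum a ψ G t x‖ := by
      rw [← card_mul_discrepancy a hψ]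
      simp [hqdef]
    rw [← mul_pow, ← sq_abs, abs_mul, abs_of_pos hq, e]
    calc _ ≤ (∑ t ∈ s, ‖phaseSum a ψ G t x‖) ^ 2 := by gcongr; exact norm_sum_le _ _
      _ ≤ s.card * ∑ t ∈ s, ‖phaseSum a ψ G t x‖ ^ 2 := sq_sum_le_card_mul_sum_sq
      _ ≤ _ := by gcongr
  have h3 : ∀ t ∈ s, ∑ x, ‖phaseSum a ψ G t x‖ ^ 2 = q ^ d * G.card := by
    intro t ht
    have := sum_phaseSum_self a h2 hψ ha G (t := t) (by simpa [hs] using ht)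
    simp_rw [Complex.mul_conj, Complex.normSq_eq_norm_sq] at this
    rw [hqdef]
    exact_mod_cast this
  have h4 : (∑ x, discrepancy a G x ^ 2) * q ^ 2 ≤ (q ^ d * G.card) * q ^ 2 := by
    rw [Finset.sum_mul]
    calc _ ≤ ∑ x, q * ∑ t ∈ s, ‖phaseSum a ψ G t x‖ ^ 2 := Finset.sum_le_sum fun x _ => h1 x
      _ = q * ∑ t ∈ s, (q ^ d * G.card) := by
          rw [← Finset.mul_sum, Finset.sum_comm, Finset.sum_congr rfl h3]
      _ = s.card * (q * (q ^ d * G.card)) := by rw [Finset.sum_const, nsmul_eq_mul]; ring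
      _ ≤ q * (q * (q ^ d * G.card)) := by gcongr
      _ = _ := by ring
  exact le_of_mul_le_mul_right h4 (by positivity)

/-- Expanding the square in place of Cauchy–Schwarz saves a factor `q` on the diagonal frequencies.
The price is an off-diagonal term quadratic in `|G|`, so this is the better bound for small `G`. -/
lemma sum_sq_discrepancy_le' (h2 : (2 : F) ≠ 0) (ha : ∀ j, a j ≠ 0) {k : ℕ} (hk : d = k + k)
    (G : Finset (Fin d → F)) :
    (∑ x, discrepancy a G x ^ 2) * Fintype.card F ≤
      (Fintype.card F : ℝ) ^ d * G.card +
        (Fintype.card F : ℝ) ^ (k + 1) * (G.card : ℝ) ^ 2 := by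
  classical
  obtain ⟨ψ, hψ⟩ := exists_addChar_ne_one F
  set q : ℝ := (Fintype.card F : ℝ) with hqdef
  have hq : 0 < q := by rw [hqdef]; exact_mod_cast Fintype.card_pos
  set s := Finset.univ.erase (0 : F) with hs
  have hcard : (s.card : ℝ) ≤ q := by
    rw [hqdef]; exact_mod_cast Finset.card_le_univ s
  have e : ((((∑ x, discrepancy a G x ^ 2) * q ^ 2 : ℝ)) : ℂ) =
      ∑ t ∈ s, ∑ t' ∈ s, ∑ x, phaseSum a ψ G t x * (starRingEnd ℂ) (phaseSum a ψ G t' x) := by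
    push_cast
    rw [Finset.sum_mul]
    have : ∀ x, (discrepancy a G x : ℂ) ^ 2 * (q : ℂ) ^ 2 =
        ∑ t ∈ s, ∑ t' ∈ s, phaseSum a ψ G t x * (starRingEnd ℂ) (phaseSum a ψ G t' x) := by
      intro x
      rw [← Finset.sum_mul_sum, ← map_sum, ← card_mul_discrepancy a hψ]
      simp only [map_mul, Complex.conj_ofReal, map_natCast, hqdef, Complex.ofReal_natCast]
      ring
    rw [Finset.sum_congr rfl fun x _ => this x, Finset.sum_comm]
    exact Finset.sum_congr rfl fun t _ => Finset.sum_comm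
  have hb : ∀ t ∈ s, ∀ t' ∈ s,
      ‖∑ x, phaseSum a ψ G t x * (starRingEnd ℂ) (phaseSum a ψ G t' x)‖ ≤
        (if t = t' then q ^ d * G.card else 0) + q ^ k * (G.card : ℝ) ^ 2 := by
    intro t ht t' _
    split_ifs with h
    · subst h
      rw [sum_phaseSum_self a h2 hψ ha G (t := t) (by simpa [hs] using ht)]
      have : (0 : ℝ) ≤ q ^ k * (G.card : ℝ) ^ 2 := by positivity
      simpa [hqdef] using this
    · rw [zero_add]
      exact norm_sum_phaseSum_le a h2 hψ ha hk G h
  have hn : (∑ x, discrepancy a G x ^ 2) * q ^ 2 ≤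
      q * (q ^ d * G.card) + q * (q * (q ^ k * (G.card : ℝ) ^ 2)) := by
    have h0 : 0 ≤ (∑ x, discrepancy a G x ^ 2) * q ^ 2 := by positivity
    calc (∑ x, discrepancy a G x ^ 2) * q ^ 2
        = ‖((((∑ x, discrepancy a G x ^ 2) * q ^ 2 : ℝ)) : ℂ)‖ := by
          rw [Complex.norm_real, Real.norm_of_nonneg h0]
      _ ≤ ∑ t ∈ s, ∑ t' ∈ s, ((if t = t' then q ^ d * G.card else 0) +
            q ^ k * (G.card : ℝ) ^ 2) := by
          rw [e]
          exact (norm_sum_le _ _).trans (Finset.sum_le_sum fun t ht =>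
            (norm_sum_le _ _).trans (Finset.sum_le_sum fun t' ht' => hb t ht t' ht'))
      _ = s.card * (q ^ d * G.card) + s.card * (s.card * (q ^ k * (G.card : ℝ) ^ 2)) := by
          simp only [Finset.sum_add_distrib, Finset.sum_ite_eq, Finset.sum_const, nsmul_eq_mul]
          congr 1
          rw [Finset.sum_ite_mem, Finset.inter_self, Finset.sum_const, nsmul_eq_mul]
      _ ≤ _ := by gcongr
  refine le_of_mul_le_mul_right ?_ hq
  calc _ = (∑ x, discrepancy a G x ^ 2) * q ^ 2 := by ring
    _ ≤ _ := hn
    _ = _ := by ring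

/-- The discrepancy of the single point `0`, summed over `x`: each nonzero frequency contributes a
complete quadratic sum of modulus `q^k`. -/
lemma abs_ncard_quadric_sub_le (h2 : (2 : F) ≠ 0) (ha : ∀ j, a j ≠ 0) {k : ℕ}
    (hk : d = k + k) :
    |((quadric a).ncard : ℝ) * Fintype.card F - (Fintype.card F : ℝ) ^ d| ≤
      (Fintype.card F : ℝ) ^ (k + 1) := by
  classical
  obtain ⟨ψ, hψ⟩ := exists_addChar_ne_one F
  set q : ℝ := (Fintype.card F : ℝ) with hqdef
  set s := Finset.univ.erase (0 : F) with hs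
  have hcard : (s.card : ℝ) ≤ q := by
    rw [hqdef]; exact_mod_cast Finset.card_le_univ s
  have hq : 0 < q := by rw [hqdef]; exact_mod_cast Fintype.card_pos
  have hd : ∀ x, discrepancy a {0} x = (if x ∈ quadric a then 1 else 0) - 1 / q := by
    intro x
    rw [discrepancy, Finset.filter_singleton]
    simp only [sub_zero]
    split_ifs <;> simp [hqdef]
  have hsum : ∑ x, discrepancy a {0} x * q = (quadric a).ncard * q - q ^ d := by
    have hc : (quadric a).ncard = (Finset.univ.filter fun x => x ∈ quadric a).card := by
      rw [← Set.ncard_coe_finset]; simp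
    rw [← Finset.sum_mul, Finset.sum_congr rfl fun x _ => hd x, Finset.sum_sub_distrib, hc,
      Finset.sum_boole, Finset.sum_const, Finset.card_univ]
    simp only [Fintype.card_pi, Finset.prod_const, Finset.card_univ, Fintype.card_fin,
      nsmul_eq_mul, Nat.cast_pow]
    rw [sub_mul, ← hqdef]
    field_simp
  have hb : ∀ t ∈ s, ‖∑ x, phaseSum a ψ {0} t x‖ ≤ q ^ k := by
    intro t ht
    refine le_of_sq_le_sq ?_ (by positivity)
    have := norm_sum_addChar_kernel a h2 hψ ha (s := t) (t := 0) (by simpa [hs] using ht) 0 0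
    simp only [zero_mul, sub_zero] at this
    simp only [phaseSum, Finset.sum_singleton, sub_zero]
    rw [this, hk, pow_add, sq]
  have e : (((∑ x, discrepancy a {0} x * q : ℝ)) : ℂ) = ∑ t ∈ s, ∑ x, phaseSum a ψ {0} t x := by
    rw [Finset.sum_comm]
    push_cast
    exact Finset.sum_congr rfl fun x _ => by
      rw [← card_mul_discrepancy a hψ]; simp [hqdef]
  rw [← hsum, ← Real.norm_eq_abs, ← Complex.norm_real, e]
  calc _ ≤ ∑ t ∈ s, q ^ k := (norm_sum_le _ _).trans (Finset.sum_le_sum hb)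
    _ = s.card * q ^ k := by simp
    _ ≤ q * q ^ k := by gcongr
    _ = _ := by ring

/-- The quadric has about `q ^ (d - 1)` points. -/
lemma ncard_quadric_bounds (h2 : (2 : F) ≠ 0) (ha : ∀ j, a j ≠ 0) {k : ℕ}
    (hk : d = k + k) (hk2 : 2 ≤ k) :
    (Fintype.card F : ℝ) ^ (d - 1) ≤ 2 * (quadric a).ncard ∧
      ((quadric a).ncard : ℝ) ≤ 2 * (Fintype.card F : ℝ) ^ (d - 1) := by
  have h := abs_ncard_quadric_sub_le a h2 ha hk
  set q : ℝ := (Fintype.card F : ℝ) with hqdef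
  have hq : 2 ≤ q := by
    have := Fintype.one_lt_card (α := F)
    rw [hqdef]; exact_mod_cast this
  -- Since `k ≥ 2`, the error in the point count is at most half of the main term.
  have hpow : q ^ (k + 1) * 2 ≤ q ^ d := by
    calc q ^ (k + 1) * 2 ≤ q ^ (k + 1) * q := by gcongr
      _ = q ^ (k + 2) := by ring
      _ ≤ q ^ d := pow_le_pow_right₀ (by linarith) (by omega)
  have hd : q ^ d = q ^ (d - 1) * q := by rw [← pow_succ]; congr 1; omega
  rw [abs_le] at h
  have hq0 : 0 < q := by linarith
  constructor
  · refine le_of_mul_le_mul_right ?_ hq0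
    nlinarith
  · refine le_of_mul_le_mul_right ?_ hq0
    have : 0 ≤ q ^ d := by positivity
    nlinarith

end CharacterSums

end QuadricAveraging

end

noncomputable section

namespace QuadricAveraging

/-! ### `L^r` bounds for single sets and their dyadic summation. -/

section LevelSets

lemma Lp_sum_le {ι X : Type*} [Fintype X] {r : ℝ} (hr : 1 ≤ r) (s : Finset ι)
    {u : ι → X → ℝ} (hu : ∀ i x, 0 ≤ u i x) :
    (∑ x, (∑ i ∈ s, u i x) ^ r) ^ (1 / r) ≤ ∑ i ∈ s, (∑ x, u i x ^ r) ^ (1 / r) := by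
  classical
  have hr0 : r ≠ 0 := by linarith
  induction s using Finset.induction_on with
  | empty => simp [Real.zero_rpow hr0, Real.zero_rpow (inv_ne_zero hr0)]
  | insert i s hi ih =>
    simp_rw [Finset.sum_insert hi]
    refine (Real.Lp_add_le_of_nonneg Finset.univ hr (fun x _ => hu i x)
      (fun x _ => Finset.sum_nonneg fun j _ => hu j x)).trans ?_
    gcongr

/-- Summation of a sequence dominated by `A ρ^j + B σ^j` and, past `m`, by `D ρ^j`. -/
lemma sum_range_le_of_geometric {ρ σ A B D q : ℝ} (hρ0 : 0 < ρ) (hρ : ρ < 1) (hσ : 1 < σ)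
    (hA : 0 ≤ A) (hB : 0 ≤ B) (hD : 0 ≤ D) {t : ℕ → ℝ} (ht : ∀ j, 0 ≤ t j) (m J : ℕ)
    (h1 : ∀ j, t j ≤ A * ρ ^ j + B * σ ^ j) (h2 : ∀ j, t j ≤ D * ρ ^ j)
    (hAq : A ≤ q) (hBq : B * σ ^ m ≤ q) (hDq : D * ρ ^ (m + 1) ≤ q) :
    ∑ j ∈ Finset.range J, t j ≤ (2 / (1 - ρ) + σ / (σ - 1)) * q := by
  have hgeo : ∀ n, ∑ j ∈ Finset.range n, ρ ^ j ≤ 1 / (1 - ρ) := by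
    intro n
    rw [geom_sum_eq hρ.ne, ← neg_div_neg_eq]
    have : 0 < ρ ^ n := by positivity
    have h' : 0 < 1 - ρ := by linarith
    rw [neg_sub, neg_sub]
    gcongr
    linarith
  have hgeoσ : ∑ j ∈ Finset.range (m + 1), σ ^ j ≤ σ ^ m * (σ / (σ - 1)) := by
    rw [geom_sum_eq hσ.ne', mul_div_assoc', ← pow_succ]
    have h' : 0 < σ - 1 := by linarith
    gcongr
    linarith
  have h' : 0 < 1 - ρ := by linarith
  have h'' : 0 < σ - 1 := by linarith
  -- The range is enlarged so that the split after `m` makes sense even when `J ≤ m`.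
  calc ∑ j ∈ Finset.range J, t j ≤ ∑ j ∈ Finset.range (m + 1 + J), t j :=
        Finset.sum_le_sum_of_subset_of_nonneg
          (Finset.range_subset_range.2 (by omega)) (fun j _ _ => ht j)
    _ = ∑ j ∈ Finset.range (m + 1), t j + ∑ i ∈ Finset.range J, t (m + 1 + i) :=
        Finset.sum_range_add _ _ _
    _ ≤ ∑ j ∈ Finset.range (m + 1), (A * ρ ^ j + B * σ ^ j) +
          ∑ i ∈ Finset.range J, D * ρ ^ (m + 1) * ρ ^ i := by
        gcongr with j _ i _
        · exact h1 j
        · rw [mul_assoc, ← pow_add]; exact h2 _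
    _ = A * ∑ j ∈ Finset.range (m + 1), ρ ^ j + B * ∑ j ∈ Finset.range (m + 1), σ ^ j +
          D * ρ ^ (m + 1) * ∑ i ∈ Finset.range J, ρ ^ i := by
        rw [Finset.sum_add_distrib, Finset.mul_sum, Finset.mul_sum, Finset.mul_sum]
    _ ≤ A * (1 / (1 - ρ)) + B * (σ ^ m * (σ / (σ - 1))) +
          D * ρ ^ (m + 1) * (1 / (1 - ρ)) := by
        gcongr
        · exact hgeo _
        · exact hgeo _
    _ = A * (1 / (1 - ρ)) + B * σ ^ m * (σ / (σ - 1)) +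
          D * ρ ^ (m + 1) * (1 / (1 - ρ)) := by ring
    _ ≤ q * (1 / (1 - ρ)) + q * (σ / (σ - 1)) + q * (1 / (1 - ρ)) := by gcongr
    _ = _ := by ring

variable {F : Type*} [Field F] [Fintype F] {d : ℕ} (a : Fin d → F)

lemma sum_abs_discrepancy_pow_le (G : Finset (Fin d → F)) {n : ℕ} :
    ∑ x, |discrepancy a G x| ^ (n + 2) ≤ (G.card : ℝ) ^ n * ∑ x, discrepancy a G x ^ 2 := by
  rw [Finset.mul_sum]
  refine Finset.sum_le_sum fun x _ => ?_
  rw [pow_add, sq_abs]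
  gcongr
  exact abs_discrepancy_le a G x

/-- Each `L²` bound is combined with the sup bound `|G|`. Up to constants the second estimate is the
smaller for `N ≤ q^k`, the first for larger `N`. -/
lemma Lp_discrepancy_le (h2 : (2 : F) ≠ 0) (ha : ∀ j, a j ≠ 0) {k : ℕ} (hk : d = k + k)
    (hk2 : 2 ≤ k) (G : Finset (Fin d → F)) {N r : ℝ} (hr : r = 2 * k - 1)
    (hN : (G.card : ℝ) ≤ N) :
    (∑ x, |discrepancy a G x| ^ r) ^ (1 / r) ≤
        (Fintype.card F : ℝ) ^ (2 * k / r) * N ^ ((r - 1) / r) ∧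
    (∑ x, |discrepancy a G x| ^ r) ^ (1 / r) ≤
        Fintype.card F * N ^ ((r - 1) / r) + (Fintype.card F : ℝ) ^ (k / r) * N := by
  set q : ℝ := (Fintype.card F : ℝ) with hqdef
  have hq : 0 < q := by rw [hqdef]; exact_mod_cast Fintype.card_pos
  have hN0 : 0 ≤ N := le_trans (by positivity) hN
  obtain ⟨n, hn⟩ : ∃ n, d - 1 = n + 2 := ⟨d - 3, by omega⟩
  have hrn : r = ((n + 2 : ℕ) : ℝ) := by
    have : n + 3 = k + k := by omega
    have : (n : ℝ) + 3 = k + k := by exact_mod_cast this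
    push_cast; linarith
  have hr0 : 0 < r := by rw [hrn]; positivity
  have hr1 : 1 ≤ r := by rw [hrn]; push_cast; linarith [(Nat.cast_nonneg n : (0 : ℝ) ≤ n)]
  have hsum : ∑ x, |discrepancy a G x| ^ r ≤ N ^ n * ∑ x, discrepancy a G x ^ 2 := by
    simp_rw [hrn, Real.rpow_natCast]
    refine (sum_abs_discrepancy_pow_le a G).trans ?_
    gcongr
  have hs0 : 0 ≤ ∑ x, |discrepancy a G x| ^ r := by positivity
  have hNr : (N ^ (n + 1)) ^ (1 / r) = N ^ ((r - 1) / r) := by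
    rw [← Real.rpow_natCast, ← Real.rpow_mul hN0, hrn]
    push_cast
    congr 1
    ring
  constructor
  · calc _ ≤ (N ^ n * (q ^ d * N)) ^ (1 / r) := by
          gcongr
          refine hsum.trans ?_
          gcongr
          refine (sum_sq_discrepancy_le a h2 ha G).trans ?_
          gcongr
      _ = (q ^ d * N ^ (n + 1)) ^ (1 / r) := by congr 1; ring
      _ = _ := by
          rw [Real.mul_rpow (by positivity) (by positivity), hNr, ← Real.rpow_natCast,
            ← Real.rpow_mul hq.le, hk]
          push_cast
          congr 2
          ring
  · have hS : ∑ x, discrepancy a G x ^ 2 ≤ q ^ (n + 2) * N + q ^ k * N ^ 2 := by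
      refine le_of_mul_le_mul_right ?_ hq
      refine (sum_sq_discrepancy_le' a h2 ha hk G).trans ?_
      calc _ ≤ q ^ d * N + q ^ (k + 1) * N ^ 2 := by gcongr
        _ = _ := by
          rw [show d = n + 2 + 1 by omega]
          ring
    calc _ ≤ (N ^ n * (q ^ (n + 2) * N + q ^ k * N ^ 2)) ^ (1 / r) := by
          gcongr
          exact hsum.trans (by gcongr)
      _ = (q ^ (n + 2) * N ^ (n + 1) + q ^ k * N ^ (n + 2)) ^ (1 / r) := by congr 1; ring
      _ ≤ (q ^ (n + 2) * N ^ (n + 1)) ^ (1 / r) + (q ^ k * N ^ (n + 2)) ^ (1 / r) :=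
          Real.rpow_add_le_add_rpow (by positivity) (by positivity) (by positivity)
            ((div_le_one hr0).2 hr1)
      _ = _ := by
          rw [Real.mul_rpow (by positivity) (by positivity), hNr,
            Real.mul_rpow (by positivity) (by positivity)]
          have e : ∀ z : ℝ, 0 ≤ z → (z ^ (n + 2)) ^ (1 / r) = z := fun z hz => by
            rw [← Real.rpow_natCast, ← Real.rpow_mul hz, ← hrn, mul_one_div_cancel hr0.ne',
              Real.rpow_one]
          rw [e q hq.le, e N hN0, ← Real.rpow_natCast, ← Real.rpow_mul hq.le, mul_one_div]

/-- The exponent `p` at the vertex with `r = d - 1`, `d = 2 k`. -/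
def vertexExponent (k : ℕ) : ℝ := (k * (2 * k - 1)) / (2 * k ^ 2 - 2 * k + 1)

/-- The first identity balances the rising series at the crossover, and twice it balances the main
term. The second makes the decay rate of the falling series positive. -/
lemma vertexExponent_spec {k : ℕ} (hk : 2 ≤ k) :
    1 < vertexExponent k ∧ vertexExponent k ≤ 2 ∧
      k / (2 * k - 1 : ℝ) + k * ((vertexExponent k - 1) / vertexExponent k) = 1 ∧
      1 / vertexExponent k - (2 * k - 1 - 1) / (2 * k - 1) = 1 / (k * (2 * k - 1)) := by
  have h : (2 : ℝ) ≤ k := by exact_mod_cast hk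
  have hden : (0 : ℝ) < 2 * k ^ 2 - 2 * k + 1 := by nlinarith
  have h3 : (0 : ℝ) < 2 * k - 1 := by linarith
  have h4 : (0 : ℝ) < k := by linarith
  rw [vertexExponent]
  refine ⟨?_, ?_, ?_, ?_⟩
  · rw [lt_div_iff₀ hden]; nlinarith
  · rw [div_le_iff₀ hden]; nlinarith
  · have e : (((k : ℝ) * (2 * k - 1)) / (2 * k ^ 2 - 2 * k + 1) - 1) /
        ((k * (2 * k - 1)) / (2 * k ^ 2 - 2 * k + 1)) = (k - 1) / (k * (2 * k - 1)) := by
      rw [div_sub_one hden.ne', div_div_div_cancel_right₀ hden.ne']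
      field_simp
      ring
    rw [e, mul_div_mul_left _ _ h4.ne' |> (mul_div_assoc _ _ _).symm.trans, ← add_div,
      div_eq_one_iff_eq h3.ne']
    ring
  · rw [one_div_div]
    field_simp
    ring

/-- Summing the level set bounds at the scales `2^(-j)`. -/
lemma exists_sum_dyadic_le {k : ℕ} (hk2 : 2 ≤ k) : ∃ C : ℝ, 0 ≤ C ∧
    ∀ (q : ℝ), 1 ≤ q → ∀ (J : ℕ) (L : ℕ → ℝ), (∀ j, 0 ≤ L j) →
    (∀ j, L j ≤ q ^ (2 * k / (2 * k - 1) : ℝ) *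
      (4 * (2 ^ vertexExponent k) ^ j : ℝ) ^ ((2 * k - 1 - 1) / (2 * k - 1) : ℝ)) →
    (∀ j, L j ≤ q * (4 * (2 ^ vertexExponent k) ^ j : ℝ) ^ ((2 * k - 1 - 1) / (2 * k - 1) : ℝ) +
      q ^ (k / (2 * k - 1) : ℝ) * (4 * (2 ^ vertexExponent k) ^ j)) →
    ∑ j ∈ Finset.range J, (1 / 2 : ℝ) ^ j * L j ≤ C * q := by
  obtain ⟨hb1, -, e1, e2⟩ := vertexExponent_spec hk2
  set b := vertexExponent k
  have hk : (2 : ℝ) ≤ k := by exact_mod_cast hk2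
  set r : ℝ := 2 * k - 1 with hr
  have hr1 : 1 < r := by rw [hr]; linarith
  have hr0 : 0 < r := by linarith
  have hb0 : 0 < b := by linarith
  have hk0 : (0 : ℝ) < k := by linarith
  set α : ℝ := 1 - b * ((r - 1) / r) with hα
  have hαb : α = b * (1 / (k * r)) := by rw [← e2, hα]; field_simp
  have hα0 : 0 < α := by rw [hαb]; positivity
  set ρ : ℝ := 2 ^ (-α) with hρ
  set σ : ℝ := 2 ^ (b - 1) with hσ
  set w : ℝ := 2 ^ b with hw
  have hw1 : 1 < w := Real.one_lt_rpow (by norm_num) hb0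
  have hρ0 : 0 < ρ := by positivity
  have hρ1 : ρ < 1 := Real.rpow_lt_one_of_one_lt_of_neg (by norm_num) (by linarith)
  have hσ1 : 1 < σ := Real.one_lt_rpow (by norm_num) (by linarith)
  refine ⟨(2 / (1 - ρ) + σ / (σ - 1)) * 4, ?_, ?_⟩
  · have : 0 < 1 - ρ := by linarith
    have : 0 < σ - 1 := by linarith
    positivity
  intro q hq J L hL0 hL1 hL2
  have hq0 : 0 < q := by linarith
  -- The crossover level: the size bound `w ^ j` for the level sets passes `q ^ k` between `m` and
  -- `m + 1`.
  obtain ⟨m, hm1, hm2⟩ := exists_nat_pow_near (one_le_pow₀ hq : 1 ≤ q ^ k) hw1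
  have hwj : ∀ j : ℕ, (1 / 2 : ℝ) ^ j * (w ^ j) ^ ((r - 1) / r) = ρ ^ j := by
    intro j
    rw [one_div, ← Real.rpow_neg_one, hw, hρ, ← Real.rpow_mul_natCast (by norm_num),
      ← Real.rpow_mul_natCast (by norm_num), ← Real.rpow_mul_natCast (by norm_num),
      ← Real.rpow_mul (by norm_num), ← Real.rpow_add (by norm_num), hα]
    congr 1
    ring
  have hwj' : ∀ j : ℕ, (1 / 2 : ℝ) ^ j * w ^ j = σ ^ j := by
    intro j
    rw [← mul_pow, hσ, Real.rpow_sub (by norm_num), Real.rpow_one]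
    congr 1
    ring
  have h4 : (4 : ℝ) ^ ((r - 1) / r) ≤ 4 := by
    calc (4 : ℝ) ^ ((r - 1) / r) ≤ 4 ^ (1 : ℝ) := by
          apply Real.rpow_le_rpow_of_exponent_le (by norm_num)
          rw [div_le_one hr0]; linarith
      _ = 4 := Real.rpow_one _
  have hN : ∀ j : ℕ, (1 / 2 : ℝ) ^ j * (4 * w ^ j) ^ ((r - 1) / r) ≤ 4 * ρ ^ j := by
    intro j
    rw [Real.mul_rpow (by norm_num) (by positivity), mul_left_comm, hwj]
    gcongr
  have key := sum_range_le_of_geometric (A := 4 * q) (B := 4 * q ^ (k / r))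
    (D := 4 * q ^ (2 * k / r)) (q := 4 * q) hρ0 hρ1 hσ1 (by positivity) (by positivity)
    (by positivity) (t := fun j => (1 / 2 : ℝ) ^ j * L j)
    (fun j => mul_nonneg (by positivity) (hL0 j)) m J ?_ ?_ le_rfl ?_ ?_
  · rw [mul_assoc]; exact key
  · intro j
    calc (1 / 2 : ℝ) ^ j * L j ≤ (1 / 2 : ℝ) ^ j * (q * (4 * w ^ j) ^ ((r - 1) / r) +
          q ^ (k / r) * (4 * w ^ j)) := by gcongr; exact hL2 j
      _ = q * ((1 / 2 : ℝ) ^ j * (4 * w ^ j) ^ ((r - 1) / r)) +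
          4 * q ^ (k / r) * ((1 / 2 : ℝ) ^ j * w ^ j) := by ring
      _ ≤ q * (4 * ρ ^ j) + 4 * q ^ (k / r) * σ ^ j := by
          rw [hwj']
          exact add_le_add_left (mul_le_mul_of_nonneg_left (hN j) hq0.le) _
      _ = _ := by ring
  · intro j
    calc (1 / 2 : ℝ) ^ j * L j ≤ (1 / 2 : ℝ) ^ j *
          (q ^ (2 * k / r) * (4 * w ^ j) ^ ((r - 1) / r)) := by gcongr; exact hL1 j
      _ = q ^ (2 * k / r) * ((1 / 2 : ℝ) ^ j * (4 * w ^ j) ^ ((r - 1) / r)) := by ring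
      _ ≤ q ^ (2 * k / r) * (4 * ρ ^ j) := mul_le_mul_of_nonneg_left (hN j) (by positivity)
      _ = _ := by ring
  · have hσm : σ ^ m ≤ q ^ (k * ((b - 1) / b)) := by
      calc σ ^ m = (w ^ m) ^ ((b - 1) / b) := by
            rw [hσ, hw, ← Real.rpow_mul_natCast (by norm_num),
              ← Real.rpow_mul_natCast (by norm_num), ← Real.rpow_mul (by norm_num)]
            congr 1
            field_simp
        _ ≤ (q ^ k) ^ ((b - 1) / b) := by
            have : 0 ≤ (b - 1) / b := div_nonneg (by linarith) hb0.le
            gcongr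
        _ = _ := by rw [← Real.rpow_natCast, ← Real.rpow_mul hq0.le]
    calc 4 * q ^ (k / r) * σ ^ m ≤ 4 * q ^ (k / r) * q ^ (k * ((b - 1) / b)) := by gcongr
      _ = 4 * q := by rw [mul_assoc, ← Real.rpow_add hq0, e1, Real.rpow_one]
  -- Beyond the crossover the decay has gained `q ^ (-1/r)`, which reduces `q ^ (2k/r)` to `q`
  -- because `r = 2k - 1`.
  · have hρm : ρ ^ (m + 1) ≤ q ^ (-(1 / r)) := by
      calc ρ ^ (m + 1) = (w ^ (m + 1)) ^ (-(1 / (k * r))) := by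
            rw [hρ, hw, ← Real.rpow_mul_natCast (by norm_num),
              ← Real.rpow_mul_natCast (by norm_num), ← Real.rpow_mul (by norm_num), hαb]
            congr 1
            ring
        _ ≤ (q ^ k) ^ (-(1 / (k * r))) :=
            Real.rpow_le_rpow_of_nonpos (by positivity) hm2.le
              (neg_nonpos.2 (by positivity))
        _ = _ := by
            rw [← Real.rpow_natCast, ← Real.rpow_mul hq0.le]
            congr 1
            field_simp
    calc 4 * q ^ (2 * k / r) * ρ ^ (m + 1) ≤ 4 * q ^ (2 * k / r) * q ^ (-(1 / r)) := by gcongr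
      _ = 4 * q := by
        rw [mul_assoc, ← Real.rpow_add hq0]
        have : 2 * k / r + -(1 / r) = 1 := by rw [hr] at hr0 ⊢; field_simp; ring
        rw [this, Real.rpow_one]

end LevelSets

end QuadricAveraging

end

noncomputable section

namespace QuadricAveraging

/-! ### The endpoint estimate for general functions. -/

section VertexEstimate

lemma Lp_const_mul {X : Type*} [Fintype X] {r c : ℝ} (hr : 0 < r) (hc : 0 ≤ c) {u : X → ℝ}
    (hu : ∀ x, 0 ≤ u x) :
    (∑ x, (c * u x) ^ r) ^ (1 / r) = c * (∑ x, u x ^ r) ^ (1 / r) := by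
  simp_rw [Real.mul_rpow hc (hu _)]
  rw [← Finset.mul_sum, Real.mul_rpow (by positivity)
    (Finset.sum_nonneg fun x _ => Real.rpow_nonneg (hu x) _), ← Real.rpow_mul hc,
    mul_one_div_cancel hr.ne', Real.rpow_one]

lemma Lp_const {X : Type*} [Fintype X] {r c : ℝ} (hr : 0 < r) (hc : 0 ≤ c) :
    (∑ _x : X, c ^ r) ^ (1 / r) = (Fintype.card X : ℝ) ^ (1 / r) * c := by
  rw [Finset.sum_const, nsmul_eq_mul, Finset.card_univ, Real.mul_rpow (by positivity)
    (by positivity), ← Real.rpow_mul hc, mul_one_div_cancel hr.ne', Real.rpow_one]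

/-- Every nonnegative function bounded by one is comparable to a step function whose level
sets are at the heights `2^(-j)`. -/
lemma exists_dyadic_levels {X : Type*} [Fintype X] [DecidableEq X] {g : X → ℝ}
    (hg : ∀ y, 0 ≤ g y) (hg1 : ∀ y, g y ≤ 1) :
    ∃ (J : ℕ) (G : ℕ → Finset X), (∀ j, ∀ y ∈ G j, (1 / 2 : ℝ) ^ (j + 1) ≤ g y) ∧
      (∀ y, g y ≤ ∑ j ∈ Finset.range J, if y ∈ G j then (1 / 2 : ℝ) ^ j else 0) ∧
      (∀ y, ∑ j ∈ Finset.range J, (if y ∈ G j then (1 / 2 : ℝ) ^ j else 0) ≤ 2 * g y) := by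
  classical
  -- Where `g` vanishes the level is arbitrary; the filter defining the level sets discards such
  -- points.
  have h : ∀ y, ∃ n : ℕ, 0 < g y → (1 / 2 : ℝ) ^ (n + 1) < g y ∧ g y ≤ (1 / 2) ^ n := by
    intro y
    by_cases hy : 0 < g y
    · obtain ⟨n, hn⟩ := exists_nat_pow_near_of_lt_one hy (hg1 y)
        (by norm_num : (0 : ℝ) < 1 / 2) (by norm_num)
      exact ⟨n, fun _ => hn⟩
    · exact ⟨0, fun h => absurd h hy⟩
  choose l hl using h
  have hsum : ∀ y, ∑ j ∈ Finset.range (Finset.univ.sup l + 1),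
      (if y ∈ Finset.univ.filter (fun y => 0 < g y ∧ l y = j) then (1 / 2 : ℝ) ^ j else 0) =
      if 0 < g y then (1 / 2) ^ l y else 0 := by
    intro y
    have hy : l y ∈ Finset.range (Finset.univ.sup l + 1) :=
      Finset.mem_range.2 (Nat.lt_succ_of_le (Finset.le_sup (Finset.mem_univ y)))
    rw [Finset.sum_eq_single_of_mem _ hy]
    · simp
    · intro j _ hj
      simp [hj.symm]
  refine ⟨Finset.univ.sup l + 1, fun j => Finset.univ.filter fun y => 0 < g y ∧ l y = j,
    ?_, ?_, ?_⟩
  · intro j y hy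
    obtain ⟨h1, rfl⟩ := (Finset.mem_filter.1 hy).2
    exact (hl y h1).1.le
  · intro y
    rw [hsum]
    split_ifs with h
    · exact (hl y h).2
    · exact not_lt.1 h
  · intro y
    rw [hsum]
    split_ifs with h
    · have := (hl y h).1
      rw [pow_succ] at this
      linarith
    · linarith [hg y]

/-- Chebyshev's inequality; the `4` absorbs the shift from `j + 1` to `j`, as `2 ^ b ≤ 4`. -/
lemma card_level_le {X : Type*} [Fintype X] {g : X → ℝ} (hg : ∀ y, 0 ≤ g y) {b : ℝ}
    (hb0 : 0 < b) (hb2 : b ≤ 2) (hgb : ∑ y, g y ^ b ≤ 1) {G : Finset X} {j : ℕ}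
    (hG : ∀ y ∈ G, (1 / 2 : ℝ) ^ (j + 1) ≤ g y) : (G.card : ℝ) ≤ 4 * (2 ^ b) ^ j := by
  have h1 : (G.card : ℝ) * (((2 : ℝ) ^ b) ^ (j + 1))⁻¹ ≤ 1 := by
    have e : (((2 : ℝ) ^ b) ^ (j + 1))⁻¹ = ((1 / 2 : ℝ) ^ (j + 1)) ^ b := by
      rw [one_div, inv_pow, Real.inv_rpow (by positivity), ← Real.rpow_natCast,
        ← Real.rpow_natCast, ← Real.rpow_mul (by norm_num), ← Real.rpow_mul (by norm_num), mul_comm]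
    rw [e, ← nsmul_eq_mul, ← Finset.sum_const]
    calc _ ≤ ∑ y ∈ G, g y ^ b := Finset.sum_le_sum fun y hy =>
          Real.rpow_le_rpow (by positivity) (hG y hy) hb0.le
      _ ≤ ∑ y, g y ^ b := Finset.sum_le_sum_of_subset_of_nonneg (Finset.subset_univ _)
          fun y _ _ => Real.rpow_nonneg (hg y) _
      _ ≤ 1 := hgb
  rw [← div_eq_mul_inv, div_le_one (by positivity), pow_succ] at h1
  have h2 : (2 : ℝ) ^ b ≤ 4 := by
    calc (2 : ℝ) ^ b ≤ 2 ^ (2 : ℝ) := Real.rpow_le_rpow_of_exponent_le (by norm_num) hb2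
      _ = 4 := by norm_num
  calc (G.card : ℝ) ≤ _ := h1
    _ ≤ (2 ^ b) ^ j * 4 := by gcongr
    _ = _ := by ring

open Classical in
/-- The sum of `g` over the translate `x - V`. -/
def translateSum {d : ℕ} {F : Type*} [Field F] [Fintype F] (V : Set (Fin d → F))
    (g : (Fin d → F) → ℝ) (x : Fin d → F) : ℝ :=
  ∑ y ∈ V.toFinset, g (x - y)

open Classical in
lemma translateSum_eq {d : ℕ} {F : Type*} [Field F] [Fintype F] (V : Set (Fin d → F))
    (g : (Fin d → F) → ℝ) (x : Fin d → F) :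
    translateSum V g x = ∑ y, if x - y ∈ V then g y else 0 := by
  rw [translateSum, ← Equiv.sum_comp (Equiv.subLeft x), ← Finset.sum_filter]
  exact Finset.sum_congr (by ext; simp) fun y _ => by simp

lemma translateSum_nonneg {d : ℕ} {F : Type*} [Field F] [Fintype F] (V : Set (Fin d → F))
    {g : (Fin d → F) → ℝ} (hg : ∀ y, 0 ≤ g y) (x : Fin d → F) : 0 ≤ translateSum V g x :=
  Finset.sum_nonneg fun _ _ => hg _

/-- The endpoint estimate for normalised functions. -/
lemma exists_translateSum_Lp_le_of_sum_le_one {k d : ℕ} (hk : d = k + k) (hk2 : 2 ≤ k) :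
    ∃ C : ℝ, 0 ≤ C ∧ ∀ (F : Type u) [Field F] [Fintype F] (a : Fin d → F), (2 : F) ≠ 0 →
      (∀ j, a j ≠ 0) → ∀ g : (Fin d → F) → ℝ, (∀ y, 0 ≤ g y) →
      ∑ y, g y ^ vertexExponent k ≤ 1 →
      (∑ x, translateSum (quadric a) g x ^ (2 * k - 1 : ℝ)) ^ (1 / (2 * k - 1) : ℝ) ≤
        C * Fintype.card F := by
  classical
  obtain ⟨C, hC, hsum⟩ := exists_sum_dyadic_le hk2
  obtain ⟨hb1, hb2, e1, -⟩ := vertexExponent_spec hk2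
  refine ⟨C + 2, by linarith, ?_⟩
  intro F _ _ a h2 ha g hg hgb
  set b := vertexExponent k
  set r : ℝ := 2 * k - 1 with hr
  have hkr : (2 : ℝ) ≤ k := by exact_mod_cast hk2
  have hr1 : 1 ≤ r := by rw [hr]; linarith
  have hr0 : 0 < r := by linarith
  have hb0 : 0 < b := by linarith
  set q : ℝ := (Fintype.card F : ℝ) with hqdef
  have hq1 : 1 ≤ q := by rw [hqdef]; exact_mod_cast Fintype.card_pos
  have hq : 0 < q := by linarith
  have hg1 : ∀ y, g y ≤ 1 := by
    intro y
    have h1 : g y ^ b ≤ 1 := (Finset.single_le_sum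
      (fun z _ => Real.rpow_nonneg (hg z) b) (Finset.mem_univ y)).trans hgb
    by_contra h
    exact absurd h1 (not_le.2 (Real.one_lt_rpow (not_le.1 h) hb0))
  obtain ⟨J, G, hG, hgle, hleg⟩ := exists_dyadic_levels hg hg1
  -- `c` dominates the expected counts of all level sets together; the `2` is the loss in the dyadic
  -- step function.
  set c : ℝ := 2 * (∑ y, g y) / q with hc
  have hsg : 0 ≤ ∑ y, g y := Finset.sum_nonneg fun y _ => hg y
  have hc0 : 0 ≤ c := by positivity
  have hpt : ∀ x, translateSum (quadric a) g x ≤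
      (∑ j ∈ Finset.range J, (1 / 2 : ℝ) ^ j * |discrepancy a (G j) x|) + c := by
    intro x
    have hmass : ∑ j ∈ Finset.range J, (1 / 2 : ℝ) ^ j * (G j).card ≤ 2 * ∑ y, g y := by
      rw [Finset.mul_sum]
      refine le_trans (le_of_eq ?_) (Finset.sum_le_sum fun y _ => hleg y)
      rw [Finset.sum_comm]
      refine Finset.sum_congr rfl fun j _ => ?_
      rw [Finset.sum_ite_mem, Finset.univ_inter, Finset.sum_const, nsmul_eq_mul, mul_comm]
    calc translateSum (quadric a) g x
        = ∑ y, if x - y ∈ quadric a then g y else 0 := translateSum_eq _ _ _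
      _ ≤ ∑ y, if x - y ∈ quadric a then
            (∑ j ∈ Finset.range J, if y ∈ G j then (1 / 2 : ℝ) ^ j else 0) else 0 := by
          refine Finset.sum_le_sum fun y _ => ?_
          split_ifs
          · exact hgle y
          · exact le_rfl
      _ = ∑ j ∈ Finset.range J, (1 / 2 : ℝ) ^ j *
            ((G j).filter fun y => x - y ∈ quadric a).card := by
          have e : ∀ y, (if x - y ∈ quadric a then
              (∑ j ∈ Finset.range J, if y ∈ G j then (1 / 2 : ℝ) ^ j else 0) else 0) =
              ∑ j ∈ Finset.range J,
                if y ∈ G j then (if x - y ∈ quadric a then (1 / 2 : ℝ) ^ j else 0) else 0 := by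
            intro y
            split_ifs <;> simp
          simp_rw [e]
          rw [Finset.sum_comm]
          refine Finset.sum_congr rfl fun j _ => ?_
          rw [Finset.sum_ite_mem, Finset.univ_inter, ← Finset.sum_filter, Finset.sum_const,
            nsmul_eq_mul, mul_comm]
      _ = ∑ j ∈ Finset.range J, ((1 / 2 : ℝ) ^ j * discrepancy a (G j) x +
            (1 / 2 : ℝ) ^ j * (G j).card / q) := by
          refine Finset.sum_congr rfl fun j _ => ?_
          rw [discrepancy, ← hqdef]
          ring
      _ = ∑ j ∈ Finset.range J, (1 / 2 : ℝ) ^ j * discrepancy a (G j) x +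
            (∑ j ∈ Finset.range J, (1 / 2 : ℝ) ^ j * (G j).card) / q := by
          rw [Finset.sum_add_distrib, Finset.sum_div]
      _ ≤ _ := by
          rw [hc]
          gcongr with j _
          exact le_abs_self _
  have hN : ∀ j, ((G j).card : ℝ) ≤ 4 * (2 ^ b) ^ j := fun j =>
    card_level_le hg hb0 hb2 hgb (hG j)
  have hlevels := hsum q hq1 J
    (fun j => (∑ x, |discrepancy a (G j) x| ^ r) ^ (1 / r)) (fun j => by positivity)
    (fun j => (Lp_discrepancy_le a h2 ha hk hk2 (G j) hr (hN j)).1)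
    (fun j => (Lp_discrepancy_le a h2 ha hk hk2 (G j) hr (hN j)).2)
  have hX : (Fintype.card (Fin d → F) : ℝ) = q ^ (2 * k : ℝ) := by
    rw [Fintype.card_fun, Fintype.card_fin, Nat.cast_pow, ← hqdef, hk, ← Real.rpow_natCast]
    congr 1
    push_cast
    ring
  -- Hölder's inequality on a space of `q ^ (2k)` points.
  have hL1 : ∑ y, g y ≤ (q ^ (2 * k : ℝ)) ^ ((b - 1) / b) := by
    have h1 := Real.rpow_sum_le_const_mul_sum_rpow_of_nonneg Finset.univ hb1.le
      (fun y _ => hg y)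
    rw [Finset.card_univ, hX] at h1
    have h3 : (∑ y, g y) ^ b ≤ (q ^ (2 * k : ℝ)) ^ (b - 1) :=
      h1.trans (mul_le_of_le_one_right (by positivity) hgb)
    calc ∑ y, g y = ((∑ y, g y) ^ b) ^ (1 / b) := by
          rw [← Real.rpow_mul hsg, mul_one_div_cancel hb0.ne', Real.rpow_one]
      _ ≤ ((q ^ (2 * k : ℝ)) ^ (b - 1)) ^ (1 / b) := by gcongr
      _ = _ := by rw [← Real.rpow_mul (by positivity), mul_one_div]
  have hmain : (∑ _x : Fin d → F, c ^ r) ^ (1 / r) ≤ 2 * q := by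
    rw [Lp_const hr0 hc0, hX, hc]
    calc (q ^ (2 * k : ℝ)) ^ (1 / r) * (2 * (∑ y, g y) / q)
        ≤ (q ^ (2 * k : ℝ)) ^ (1 / r) * (2 * (q ^ (2 * k : ℝ)) ^ ((b - 1) / b) / q) := by gcongr
      _ = 2 * q ^ (2 * k * (1 / r) + 2 * k * ((b - 1) / b)) / q := by
          rw [Real.rpow_add hq, Real.rpow_mul hq.le (2 * k) (1 / r),
            Real.rpow_mul hq.le (2 * k) ((b - 1) / b)]
          ring
      _ = 2 * q := by
          have : 2 * k * (1 / r) + 2 * k * ((b - 1) / b) = 2 := by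
            linear_combination 2 * e1
          rw [this, Real.rpow_two]
          field_simp
  have hT0 := translateSum_nonneg (quadric a) hg
  calc _ ≤ (∑ x, ((∑ j ∈ Finset.range J, (1 / 2 : ℝ) ^ j * |discrepancy a (G j) x|) + c) ^ r)
          ^ (1 / r) := by
        refine Real.rpow_le_rpow (Finset.sum_nonneg fun x _ => Real.rpow_nonneg (hT0 x) _)
          (Finset.sum_le_sum fun x _ => Real.rpow_le_rpow (hT0 x) (hpt x) hr0.le)
          (by positivity)
    _ ≤ (∑ x, (∑ j ∈ Finset.range J, (1 / 2 : ℝ) ^ j * |discrepancy a (G j) x|) ^ r) ^ (1 / r) +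
          (∑ _x : Fin d → F, c ^ r) ^ (1 / r) :=
        Real.Lp_add_le_of_nonneg Finset.univ hr1
          (fun x _ => Finset.sum_nonneg fun j _ => by positivity) (fun _ _ => hc0)
    _ ≤ (∑ j ∈ Finset.range J, (1 / 2 : ℝ) ^ j *
          (∑ x, |discrepancy a (G j) x| ^ r) ^ (1 / r)) + 2 * q := by
        refine add_le_add ?_ hmain
        refine (Lp_sum_le hr1 _ (fun j x => by positivity)).trans (le_of_eq ?_)
        exact Finset.sum_congr rfl fun j _ =>
          Lp_const_mul hr0 (by positivity) (fun x => abs_nonneg _)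
    _ ≤ C * q + 2 * q := by gcongr
    _ = _ := by ring

/-- Homogeneity reduces to the normalised case, apart from `g = 0`. -/
lemma exists_translateSum_Lp_le {k d : ℕ} (hk : d = k + k) (hk2 : 2 ≤ k) :
    ∃ C : ℝ, 0 ≤ C ∧ ∀ (F : Type u) [Field F] [Fintype F] (a : Fin d → F), (2 : F) ≠ 0 →
      (∀ j, a j ≠ 0) → ∀ g : (Fin d → F) → ℝ, (∀ y, 0 ≤ g y) →
      (∑ x, translateSum (quadric a) g x ^ (2 * k - 1 : ℝ)) ^ (1 / (2 * k - 1) : ℝ) ≤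
        C * Fintype.card F * (∑ y, g y ^ vertexExponent k) ^ (1 / vertexExponent k) := by
  obtain ⟨C, hC, h⟩ := exists_translateSum_Lp_le_of_sum_le_one.{u} hk hk2
  obtain ⟨hb1, -, -, -⟩ := vertexExponent_spec hk2
  refine ⟨C, hC, ?_⟩
  intro F _ _ a h2 ha g hg
  set b := vertexExponent k
  have hb0 : 0 < b := by linarith
  have hkr : (2 : ℝ) ≤ k := by exact_mod_cast hk2
  have hr0 : (0 : ℝ) < 2 * k - 1 := by linarith
  set M := (∑ y, g y ^ b) ^ (1 / b) with hM
  have hs0 : 0 ≤ ∑ y, g y ^ b := Finset.sum_nonneg fun y _ => Real.rpow_nonneg (hg y) _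
  have hM0 : 0 ≤ M := Real.rpow_nonneg hs0 _
  have hMb : M ^ b = ∑ y, g y ^ b := by
    rw [hM, ← Real.rpow_mul hs0, one_div_mul_cancel hb0.ne', Real.rpow_one]
  rcases hM0.eq_or_lt with hM0 | hM0
  · rw [← hM0, Real.zero_rpow hb0.ne', eq_comm, Finset.sum_eq_zero_iff_of_nonneg
      (fun y _ => Real.rpow_nonneg (hg y) _)] at hMb
    have hg0 : ∀ y, g y = 0 := fun y =>
      (Real.rpow_eq_zero (hg y) hb0.ne').1 (hMb y (Finset.mem_univ y))
    have : ∀ x, translateSum (quadric a) g x = 0 := fun x => by simp [translateSum, hg0]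
    simp [this, Real.zero_rpow hr0.ne', Real.zero_rpow (inv_ne_zero hr0.ne'), ← hM0]
  · have h1 := h F a h2 ha (fun y => M⁻¹ * g y)
      (fun y => mul_nonneg (inv_nonneg.2 hM0.le) (hg y)) (by
        simp_rw [Real.mul_rpow (inv_nonneg.2 hM0.le) (hg _)]
        rw [← Finset.mul_sum, ← hMb, Real.inv_rpow hM0.le, inv_mul_cancel₀ (by positivity)])
    have e : ∀ x, translateSum (quadric a) (fun y => M⁻¹ * g y) x =
        M⁻¹ * translateSum (quadric a) g x := fun x => by
      simp only [translateSum, Finset.mul_sum]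
    simp_rw [e] at h1
    rw [Lp_const_mul hr0 (inv_nonneg.2 hM0.le)
      (translateSum_nonneg _ hg), inv_mul_le_iff₀ hM0] at h1
    linarith

end VertexEstimate

end QuadricAveraging

end

noncomputable section

namespace QuadricAveraging

/-! ### The normalized counting measure. -/

section NormalizedCount

variable {X : Type*} [Fintype X]

instance isProbabilityMeasure_normalizedCount [Nonempty X] :
    @IsProbabilityMeasure X ⊤ (normalizedCount X) := by
  let _ : MeasurableSpace X := ⊤
  constructor
  rw [normalizedCount, Measure.smul_apply, Measure.count_univ, smul_eq_mul, ENat.card_eq_coe_fintype_card]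
  exact ENNReal.inv_mul_cancel (by simp) (by simp)

lemma aestronglyMeasurable_normalizedCount {E : Type*} [TopologicalSpace E] (f : X → E) :
    @AEStronglyMeasurable X E _ ⊤ ⊤ f (normalizedCount X) := by
  let _ : MeasurableSpace X := ⊤
  exact (StronglyMeasurable.of_discrete).aestronglyMeasurable

lemma normalizedCount_apply (s : Set X) :
    normalizedCount X s = (Fintype.card X : ℝ≥0∞)⁻¹ * s.ncard := by
  classical
  let _ : MeasurableSpace X := ⊤
  rw [normalizedCount, Measure.smul_apply, smul_eq_mul, Measure.count_apply (by trivial),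
    Set.encard_eq_coe_toFinset_card, Set.ncard_eq_toFinset_card']
  simp

lemma forall_of_ae_normalizedCount {P : X → Prop}
    (h : ∀ᵐ x ∂(normalizedCount X), P x) (x : X) : P x := by
  let _ : MeasurableSpace X := ⊤
  by_contra hx
  have h0 : normalizedCount X {x} = 0 :=
    measure_mono_null (by simpa using hx) (ae_iff.1 h)
  rw [normalizedCount_apply] at h0
  simp at h0

lemma eLpNorm_normalizedCount [Nonempty X] {g : X → ℝ} (hg : ∀ x, 0 ≤ g x) {p : ℝ}
    (hp : 0 < p) : eLpNorm g (ENNReal.ofReal p) (normalizedCount X) =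
      ENNReal.ofReal (((Fintype.card X : ℝ)⁻¹ * ∑ x, g x ^ p) ^ (1 / p)) := by
  let _ : MeasurableSpace X := ⊤
  have hc : (0 : ℝ) < Fintype.card X := by exact_mod_cast Fintype.card_pos
  have hs : 0 ≤ ∑ x, g x ^ p := Finset.sum_nonneg fun x _ => Real.rpow_nonneg (hg x) _
  rw [eLpNorm_eq_lintegral_rpow_enorm_toReal (by simpa using hp) ENNReal.ofReal_ne_top,
    ENNReal.toReal_ofReal hp.le, normalizedCount, lintegral_smul_measure, lintegral_count,
    tsum_fintype, smul_eq_mul, ← ENNReal.ofReal_rpow_of_nonneg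
      (mul_nonneg (by positivity) hs) (by positivity), ENNReal.ofReal_mul (by positivity), ENNReal.ofReal_inv_of_pos hc,
    ENNReal.ofReal_natCast, ENNReal.ofReal_sum_of_nonneg
      (fun x _ => Real.rpow_nonneg (hg x) _)]
  simp_rw [← ENNReal.ofReal_rpow_of_nonneg (hg _) hp.le, Real.enorm_eq_ofReal (hg _)]

end NormalizedCount

/-! ### Positivity, trivial bounds and duality for the averages. -/

section Mean

variable {d : ℕ} {F : Type*} [Field F] [Fintype F] (V : Set (Fin d → F))

/-- The averaging operator on real functions. -/
def mean (g : (Fin d → F) → ℝ) (x : Fin d → F) : ℝ := (V.ncard : ℝ)⁻¹ * translateSum V g x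

variable {V}

lemma mean_nonneg {g : (Fin d → F) → ℝ} (hg : ∀ x, 0 ≤ g x) (x : Fin d → F) :
    0 ≤ mean V g x :=
  mul_nonneg (by positivity) (translateSum_nonneg V hg x)

lemma average_ofReal (g : (Fin d → F) → ℝ) (x : Fin d → F) :
    average V (fun y => (g y : ℂ)) x = (mean V g x : ℂ) := by
  simp [average, mean, translateSum]

lemma norm_average_le (f : (Fin d → F) → ℂ) (x : Fin d → F) :
    ‖average V f x‖ ≤ mean V (fun y => ‖f y‖) x := by
  rw [average, norm_mul, norm_inv, Complex.norm_natCast, mean, translateSum]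
  gcongr
  exact norm_sum_le _ _

/-- The kernel is nonnegative, so replacing `f` by `|f|` only increases the average. -/
lemma averagingBound_iff {p r : ℝ≥0∞} {C : ℝ≥0} : AveragingBound V p r C ↔
    ∀ g : (Fin d → F) → ℝ, (∀ x, 0 ≤ g x) →
      eLpNorm (mean V g) r (normalizedCount (Fin d → F)) ≤
        C * eLpNorm g p (normalizedCount (Fin d → F)) := by
  let _ : MeasurableSpace (Fin d → F) := ⊤
  constructor
  · intro h g hg
    have h1 := h (fun x => (g x : ℂ))
    have e1 : eLpNorm (average V fun x => (g x : ℂ)) r (normalizedCount (Fin d → F)) =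
        eLpNorm (mean V g) r (normalizedCount (Fin d → F)) :=
      eLpNorm_congr_norm_ae (.of_forall fun x => by rw [average_ofReal, Complex.norm_real])
    have e2 : eLpNorm (fun x => (g x : ℂ)) p (normalizedCount (Fin d → F)) =
        eLpNorm g p (normalizedCount (Fin d → F)) :=
      eLpNorm_congr_norm_ae (.of_forall fun x => by rw [Complex.norm_real])
    rwa [e1, e2] at h1
  · intro h f
    have h1 := h (fun x => ‖f x‖) (fun x => norm_nonneg _)
    rw [eLpNorm_norm] at h1
    refine le_trans (eLpNorm_mono_real fun x => ?_) h1
    exact norm_average_le f x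

/-- The averaging bound for finite exponents, in terms of sums. -/
lemma averagingBound_ofReal_iff {p r : ℝ} (hp : 0 < p) (hr : 0 < r) {C : ℝ≥0} :
    AveragingBound V (ENNReal.ofReal p) (ENNReal.ofReal r) C ↔
    ∀ g : (Fin d → F) → ℝ, (∀ x, 0 ≤ g x) →
      ((Fintype.card (Fin d → F) : ℝ)⁻¹ * ∑ x, mean V g x ^ r) ^ (1 / r) ≤
        C * ((Fintype.card (Fin d → F) : ℝ)⁻¹ * ∑ x, g x ^ p) ^ (1 / p) := by
  rw [averagingBound_iff]
  refine forall_congr' fun g => forall_congr' fun hg => ?_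
  rw [eLpNorm_normalizedCount (mean_nonneg hg) hr, eLpNorm_normalizedCount hg hp,
    ← ENNReal.ofReal_coe_nnreal, ← ENNReal.ofReal_mul C.coe_nonneg]
  refine ENNReal.ofReal_le_ofReal_iff (mul_nonneg C.coe_nonneg (Real.rpow_nonneg
    (mul_nonneg (by positivity) (Finset.sum_nonneg fun x _ => Real.rpow_nonneg (hg x) _)) _))

lemma AveragingBound.mono_right {p r r' : ℝ≥0∞} {C : ℝ≥0} (h : AveragingBound V p r C)
    (hr : r' ≤ r) : AveragingBound V p r' C := fun f =>
  (eLpNorm_le_eLpNorm_of_exponent_le hr (aestronglyMeasurable_normalizedCount (E := ℂ) _)).trans (h f)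

/-- An average never exceeds the supremum, and norms on a probability space increase with the
exponent. This settles the vertices `(0,0)` and `(0,1)`. -/
lemma averagingBound_top (hV : V.Nonempty) (r : ℝ≥0∞) : AveragingBound V ∞ r 1 := by
  let _ : MeasurableSpace (Fin d → F) := ⊤
  refine AveragingBound.mono_right (r := ∞) ?_ le_top
  rw [averagingBound_iff]
  intro g hg
  rw [ENNReal.coe_one, one_mul, eLpNorm_exponent_top, eLpNorm_exponent_top]
  refine eLpNormEssSup_le_of_ae_enorm_bound (.of_forall fun x => ?_)
  have hb := forall_of_ae_normalizedCount
    (ae_le_eLpNormEssSup (f := g) (μ := normalizedCount (Fin d → F)))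
  set M := eLpNormEssSup g (normalizedCount (Fin d → F)) with hM
  rcases eq_or_ne M ∞ with h | h
  · rw [h]; exact le_top
  have hg' : ∀ y, g y ≤ M.toReal := fun y => by
    have := ENNReal.toReal_mono h (hb y)
    rwa [toReal_enorm, Real.norm_of_nonneg (hg y)] at this
  have hmean : mean V g x ≤ M.toReal := by
    classical
    have hc : (0 : ℝ) < V.ncard := by
      exact_mod_cast (Set.ncard_pos (Set.toFinite V)).2 hV
    rw [mean, inv_mul_le_iff₀ hc, translateSum]
    refine (Finset.sum_le_card_nsmul _ _ _ fun y _ => hg' _).trans (le_of_eq ?_)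
    rw [nsmul_eq_mul, Set.ncard_eq_toFinset_card']
  rw [Real.enorm_eq_ofReal (mean_nonneg hg x), ← ENNReal.ofReal_toReal h]
  exact ENNReal.ofReal_le_ofReal hmean

lemma sum_mean_mul (hV : ∀ x, -x ∈ V ↔ x ∈ V) (g h : (Fin d → F) → ℝ) :
    ∑ x, mean V g x * h x = ∑ x, g x * mean V h x := by
  classical
  have e : ∀ x, mean V g x * h x =
      ∑ y, if x - y ∈ V then (V.ncard : ℝ)⁻¹ * (g y * h x) else 0 := by
    intro x
    rw [mean, translateSum_eq, Finset.mul_sum, Finset.sum_mul]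
    exact Finset.sum_congr rfl fun y _ => by split_ifs <;> ring
  have e' : ∀ x, g x * mean V h x =
      ∑ y, if x - y ∈ V then (V.ncard : ℝ)⁻¹ * (g x * h y) else 0 := by
    intro x
    rw [mean, translateSum_eq, Finset.mul_sum, Finset.mul_sum]
    exact Finset.sum_congr rfl fun y _ => by split_ifs <;> ring
  simp_rw [e, e']
  rw [Finset.sum_comm]
  refine Finset.sum_congr rfl fun x _ => Finset.sum_congr rfl fun y _ => ?_
  rw [← hV, neg_sub]

/-- By self-adjointness, pairing with the constant `1` shows that averaging preserves the total
mass. -/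
lemma averagingBound_one (hV : V.Nonempty) (hV' : ∀ x, -x ∈ V ↔ x ∈ V) :
    AveragingBound V 1 1 1 := by
  rw [← ENNReal.ofReal_one, averagingBound_ofReal_iff one_pos one_pos]
  intro g hg
  have h1 : ∀ x, mean V (fun _ => (1 : ℝ)) x = 1 := by
    intro x
    have hc : (V.ncard : ℝ) ≠ 0 := by
      exact_mod_cast ((Set.ncard_pos (Set.toFinite V)).2 hV).ne'
    rw [mean, translateSum, Finset.sum_const, ← Set.ncard_eq_toFinset_card', nsmul_eq_mul, mul_one,
      inv_mul_cancel₀ hc]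
  have := sum_mean_mul hV' g (fun _ => 1)
  simp only [mul_one, h1] at this
  simp [this]

/-- Duality for the self-adjoint averaging operator over a symmetric set. -/
lemma AveragingBound.dual (hV : ∀ x, -x ∈ V ↔ x ∈ V) {p p' r r' : ℝ}
    (hp : p.HolderConjugate p') (hr : r.HolderConjugate r') {C : ℝ≥0}
    (h : AveragingBound V (ENNReal.ofReal p) (ENNReal.ofReal r) C) :
    AveragingBound V (ENNReal.ofReal r') (ENNReal.ofReal p') C := by
  rw [averagingBound_ofReal_iff hp.pos hr.pos] at h
  rw [averagingBound_ofReal_iff hr.symm.pos hp.symm.pos]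
  intro g hg
  set n : ℝ := (Fintype.card (Fin d → F) : ℝ) with hn
  have hn0 : 0 < n := by rw [hn]; exact_mod_cast Fintype.card_pos
  set w := mean V g with hw
  have hw0 : ∀ x, 0 ≤ w x := mean_nonneg hg
  set Z := n⁻¹ * ∑ x, w x ^ p' with hZ
  have hZ0 : 0 ≤ Z := mul_nonneg (by positivity)
    (Finset.sum_nonneg fun x _ => Real.rpow_nonneg (hw0 x) _)
  set A := (n⁻¹ * ∑ x, g x ^ r') ^ (1 / r') with hA
  have hA0 : 0 ≤ A := Real.rpow_nonneg (mul_nonneg (by positivity)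
    (Finset.sum_nonneg fun x _ => Real.rpow_nonneg (hg x) _)) _
  rcases hZ0.eq_or_lt with hZ0 | hZ0
  · rw [← hZ0, Real.zero_rpow (one_div_pos.2 hp.symm.pos).ne']
    exact mul_nonneg C.coe_nonneg hA0
  -- The extremal function for Hölder's inequality against `w`: both the pairing of `w` with `v` and
  -- the `p`-th power of `v` give `w ^ p'`.
  set v : (Fin d → F) → ℝ := fun x => w x ^ (p' - 1) with hv
  have hv0 : ∀ x, 0 ≤ v x := fun x => Real.rpow_nonneg (hw0 x) _
  have hvp : ∀ x, v x ^ p = w x ^ p' := fun x => by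
    rw [hv, ← Real.rpow_mul (hw0 x), hp.symm.sub_one_mul_conj]
  have hwv : ∀ x, w x * v x = w x ^ p' := fun x => by
    have h0 : p' - 1 ≠ 0 := hp.symm.sub_one_ne_zero
    nth_rw 1 [hv, ← Real.rpow_one (w x)]
    rw [← Real.rpow_add' (hw0 x) (by simpa using hp.symm.ne_zero)]
    congr 1
    ring
  have h1 : Z ≤ A * (C * Z ^ (1 / p)) := by
    calc Z = n⁻¹ * ∑ x, g x * mean V v x := by
          rw [hZ, ← sum_mean_mul hV]
          simp_rw [← hw, hwv]
      _ ≤ n⁻¹ * ((∑ x, g x ^ r') ^ (1 / r') * (∑ x, mean V v x ^ r) ^ (1 / r)) := by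
          gcongr
          exact Real.inner_le_Lp_mul_Lq_of_nonneg _ hr.symm (fun x _ => hg x)
            (fun x _ => mean_nonneg hv0 x)
      _ = A * (n⁻¹ * ∑ x, mean V v x ^ r) ^ (1 / r) := by
          rw [hA, Real.mul_rpow (by positivity)
            (Finset.sum_nonneg fun x _ => Real.rpow_nonneg (hg x) _),
            Real.mul_rpow (by positivity)
            (Finset.sum_nonneg fun x _ => Real.rpow_nonneg (mean_nonneg hv0 x) _)]
          have : n⁻¹ = n⁻¹ ^ (1 / r') * n⁻¹ ^ (1 / r) := by
            rw [← Real.rpow_add (by positivity), one_div, one_div, hr.symm.inv_add_inv_eq_one,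
              Real.rpow_one]
          nth_rw 1 [this]
          ring
      _ ≤ A * (C * Z ^ (1 / p)) := by
          refine mul_le_mul_of_nonneg_left ((h v hv0).trans (le_of_eq ?_)) hA0
          simp_rw [hvp]
          rfl
  have h2 : Z = Z ^ (1 / p') * Z ^ (1 / p) := by
    rw [← Real.rpow_add hZ0, one_div, one_div, hp.symm.inv_add_inv_eq_one, Real.rpow_one]
  have h3 : 0 < Z ^ (1 / p) := Real.rpow_pos_of_pos hZ0 _
  refine le_of_mul_le_mul_right ?_ h3
  rw [← h2]
  linarith

end Mean

/-! ### Interpolation for positive averages. -/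

section Interpolation

variable {d : ℕ} {F : Type*} [Field F] [Fintype F] {V : Set (Fin d → F)}

lemma mean_rpow_mul_rpow_le {s t : ℝ} (hs : 0 < s) (ht : 0 < t) (hst : s + t = 1)
    {g h : (Fin d → F) → ℝ} (hg : ∀ x, 0 ≤ g x) (hh : ∀ x, 0 ≤ h x) (x : Fin d → F) :
    mean V (fun y => g y ^ s * h y ^ t) x ≤ mean V g x ^ s * mean V h x ^ t := by
  classical
  have hc : (0 : ℝ) ≤ (V.ncard : ℝ)⁻¹ := by positivity
  have hH : translateSum V (fun y => g y ^ s * h y ^ t) x ≤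
      translateSum V g x ^ s * translateSum V h x ^ t := by
    have hconj : (1 / s).HolderConjugate (1 / t) :=
      Real.holderConjugate_iff.2 ⟨by rw [lt_div_iff₀ hs]; linarith, by simpa using hst⟩
    have := Real.inner_le_Lp_mul_Lq_of_nonneg V.toFinset hconj
      (f := fun y => g (x - y) ^ s) (g := fun y => h (x - y) ^ t)
      (fun y _ => Real.rpow_nonneg (hg _) _) (fun y _ => Real.rpow_nonneg (hh _) _)
    simp_rw [← Real.rpow_mul (hg _), ← Real.rpow_mul (hh _), mul_one_div_cancel hs.ne',
      mul_one_div_cancel ht.ne', Real.rpow_one, one_div_one_div] at this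
    exact this
  rw [mean, mean, mean, Real.mul_rpow hc (translateSum_nonneg V hg x),
    Real.mul_rpow hc (translateSum_nonneg V hh x)]
  calc _ ≤ (V.ncard : ℝ)⁻¹ * (translateSum V g x ^ s * translateSum V h x ^ t) := by gcongr
    _ = ((V.ncard : ℝ)⁻¹ ^ s * (V.ncard : ℝ)⁻¹ ^ t) *
          (translateSum V g x ^ s * translateSum V h x ^ t) := by
        rw [← Real.rpow_add_of_nonneg hc hs.le ht.le, hst, Real.rpow_one]
    _ = _ := by ring

lemma inv_ofReal_mul_mul_ofReal {s : ℝ} (hs : 0 < s) (y : ℝ) :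
    (ENNReal.ofReal (s * y))⁻¹ * ENNReal.ofReal s = (ENNReal.ofReal y)⁻¹ := by
  have h0 : ENNReal.ofReal s ≠ 0 := by simpa using hs
  rw [ENNReal.ofReal_mul hs.le, ENNReal.mul_inv (.inl h0) (.inl ENNReal.ofReal_ne_top), mul_right_comm,
    ENNReal.inv_mul_cancel h0 ENNReal.ofReal_ne_top, one_mul]

lemma eLpNorm_rpow_of_nonneg {X : Type*} {m : MeasurableSpace X} {μ : Measure X} {g : X → ℝ}
    (hg : ∀ x, 0 ≤ g x) {s : ℝ} (hs : 0 < s) (y : ℝ) :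
    eLpNorm (fun x => g x ^ s) (ENNReal.ofReal (s * y))⁻¹ μ =
      eLpNorm g (ENNReal.ofReal y)⁻¹ μ ^ s := by
  rw [← inv_ofReal_mul_mul_ofReal hs y, ← eLpNorm_norm_rpow _ hs]
  congr 1
  ext x
  rw [Real.norm_of_nonneg (hg x)]

/-- An inequality and not an equality because of `y = 0`, where the function is `1` and the exponent
is `∞`. -/
lemma eLpNorm_rpow_div_le {X : Type*} {m : MeasurableSpace X} {μ : Measure X}
    [IsProbabilityMeasure μ] {g : X → ℝ} (hg : ∀ x, 0 ≤ g x) {x y : ℝ} (hx : 0 < x)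
    (hy : 0 ≤ y) : eLpNorm (fun z => g z ^ (y / x)) (ENNReal.ofReal y)⁻¹ μ ≤
      eLpNorm g (ENNReal.ofReal x)⁻¹ μ ^ (y / x) := by
  rcases hy.eq_or_lt with rfl | hy
  · simpa using eLpNormEssSup_le_of_ae_enorm_bound (μ := μ) (f := fun _ => (1 : ℝ)) (C := 1)
      (.of_forall fun _ => by simp)
  · rw [← eLpNorm_rpow_of_nonneg hg (div_pos hy hx), div_mul_cancel₀ _ hx.ne']

/-- Interpolation between two estimates for the positive operator `f ↦ f * dσ`. -/
lemma AveragingBound.interpolate (hV : V.Nonempty) {x₀ y₀ x₁ y₁ s t : ℝ} (hx₀ : 0 ≤ x₀)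
    (hy₀ : 0 ≤ y₀) (hx₁ : 0 ≤ x₁) (hy₁ : 0 ≤ y₁) (hs : 0 < s) (ht : 0 < t)
    (hst : s + t = 1) {C₀ C₁ : ℝ≥0}
    (h₀ : AveragingBound V (ENNReal.ofReal x₀)⁻¹ (ENNReal.ofReal y₀)⁻¹ C₀)
    (h₁ : AveragingBound V (ENNReal.ofReal x₁)⁻¹ (ENNReal.ofReal y₁)⁻¹ C₁) :
    AveragingBound V (ENNReal.ofReal (s * x₀ + t * x₁))⁻¹ (ENNReal.ofReal (s * y₀ + t * y₁))⁻¹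
      (max 1 (C₀ ^ s * C₁ ^ t)) := by
  let _ : MeasurableSpace (Fin d → F) := ⊤
  set x := s * x₀ + t * x₁ with hx
  have hx0 : 0 ≤ x := by positivity
  -- If `x = 0` the input norm is `L^∞` and the trivial bound applies with constant `1`; hence the
  -- `max 1` in the statement.
  rcases hx0.eq_or_lt with hx0 | hx0
  · rw [← hx0, ENNReal.ofReal_zero, ENNReal.inv_zero]
    intro f
    refine (averagingBound_top hV _ f).trans ?_
    gcongr
    exact le_max_left _ _
  rw [averagingBound_iff] at h₀ h₁ ⊢
  intro g hg
  set μ := normalizedCount (Fin d → F)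
  -- The powers are chosen so that `g = g₀ ^ s * g₁ ^ t`, while the norms of `g₀`, `g₁` at their own
  -- exponents are controlled by powers of the norm of `g`.
  set g₀ : (Fin d → F) → ℝ := fun z => g z ^ (x₀ / x)
  set g₁ : (Fin d → F) → ℝ := fun z => g z ^ (x₁ / x)
  have hg₀ : ∀ z, 0 ≤ g₀ z := fun z => Real.rpow_nonneg (hg z) _
  have hg₁ : ∀ z, 0 ≤ g₁ z := fun z => Real.rpow_nonneg (hg z) _
  have hsum : x₀ / x * s + x₁ / x * t = 1 := by
    rw [div_mul_eq_mul_div, div_mul_eq_mul_div, ← add_div, div_eq_one_iff_eq hx0.ne', hx]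
    ring
  have hfac : g = fun z => g₀ z ^ s * g₁ z ^ t := by
    ext z
    rw [← Real.rpow_mul (hg z), ← Real.rpow_mul (hg z),
      ← Real.rpow_add_of_nonneg (hg z) (by positivity) (by positivity), hsum, Real.rpow_one]
  have hpt : ∀ z, ‖mean V g z‖ ≤ ((fun z => mean V g₀ z ^ s) • fun z => mean V g₁ z ^ t) z := by
    intro z
    rw [Real.norm_of_nonneg (mean_nonneg hg z)]
    nth_rw 1 [hfac]
    exact mean_rpow_mul_rpow_le hs ht hst hg₀ hg₁ z
  have : ENNReal.HolderTriple (ENNReal.ofReal (s * y₀))⁻¹ (ENNReal.ofReal (t * y₁))⁻¹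
      (ENNReal.ofReal (s * y₀ + t * y₁))⁻¹ :=
    ⟨by rw [inv_inv, inv_inv, inv_inv, ENNReal.ofReal_add (by positivity) (by positivity)]⟩
  set N := eLpNorm g (ENNReal.ofReal x)⁻¹ μ with hN
  calc eLpNorm (mean V g) (ENNReal.ofReal (s * y₀ + t * y₁))⁻¹ μ
      ≤ eLpNorm ((fun z => mean V g₀ z ^ s) • fun z => mean V g₁ z ^ t)
          (ENNReal.ofReal (s * y₀ + t * y₁))⁻¹ μ := eLpNorm_mono_real hpt
    _ ≤ eLpNorm (fun z => mean V g₀ z ^ s) (ENNReal.ofReal (s * y₀))⁻¹ μ *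
          eLpNorm (fun z => mean V g₁ z ^ t) (ENNReal.ofReal (t * y₁))⁻¹ μ :=
        eLpNorm_smul_le_mul_eLpNorm (aestronglyMeasurable_normalizedCount (E := ℝ) _)
          (aestronglyMeasurable_normalizedCount (E := ℝ) _)
    _ = eLpNorm (mean V g₀) (ENNReal.ofReal y₀)⁻¹ μ ^ s *
          eLpNorm (mean V g₁) (ENNReal.ofReal y₁)⁻¹ μ ^ t := by
        rw [eLpNorm_rpow_of_nonneg (mean_nonneg hg₀) hs, eLpNorm_rpow_of_nonneg (mean_nonneg hg₁) ht]
    _ ≤ (C₀ * N ^ (x₀ / x)) ^ s * (C₁ * N ^ (x₁ / x)) ^ t := by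
        gcongr
        · exact (h₀ g₀ hg₀).trans (by gcongr; exact eLpNorm_rpow_div_le hg hx0 hx₀)
        · exact (h₁ g₁ hg₁).trans (by gcongr; exact eLpNorm_rpow_div_le hg hx0 hx₁)
    _ = ((C₀ : ℝ≥0∞) ^ s * (C₁ : ℝ≥0∞) ^ t) * (N ^ (x₀ / x * s) * N ^ (x₁ / x * t)) := by
        rw [ENNReal.mul_rpow_of_nonneg _ _ hs.le, ENNReal.mul_rpow_of_nonneg _ _ ht.le,
          ← ENNReal.rpow_mul, ← ENNReal.rpow_mul]
        ring
    _ = ((C₀ ^ s * C₁ ^ t : ℝ≥0) : ℝ≥0∞) * N := by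
        rw [← ENNReal.rpow_add_of_nonneg _ _ (by positivity) (by positivity), hsum,
          ENNReal.rpow_one, ENNReal.coe_mul, ENNReal.coe_rpow_of_nonneg _ hs.le,
          ENNReal.coe_rpow_of_nonneg _ ht.le]
    _ ≤ _ := by
        gcongr
        exact le_max_right _ _

end Interpolation

/-! ### The vertex bound in normalized form. -/

section VertexBounds

lemma exists_averagingBound_vertex {k d : ℕ} (hk : d = k + k) (hk2 : 2 ≤ k) :
    ∃ C : ℝ≥0, ∀ (F : Type u) [Field F] [Fintype F] (a : Fin d → F), (2 : F) ≠ 0 →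
      (∀ j, a j ≠ 0) → AveragingBound (quadric a) (ENNReal.ofReal (vertexExponent k))
        (ENNReal.ofReal (2 * k - 1)) C := by
  obtain ⟨C, hC, h⟩ := exists_translateSum_Lp_le.{u} hk hk2
  obtain ⟨hb1, -, -, e2⟩ := vertexExponent_spec hk2
  refine ⟨(2 * C).toNNReal, ?_⟩
  intro F _ _ a h2 ha
  have hkr : (2 : ℝ) ≤ k := by exact_mod_cast hk2
  set b := vertexExponent k
  set r : ℝ := 2 * k - 1 with hr
  have hr0 : 0 < r := by rw [hr]; linarith
  have hb0 : 0 < b := by linarith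
  rw [averagingBound_ofReal_iff hb0 hr0]
  intro g hg
  have h1 := h F a h2 ha g hg
  have hV := (ncard_quadric_bounds a h2 ha hk hk2).1
  set q : ℝ := (Fintype.card F : ℝ) with hqdef
  have hq : 0 < q := by rw [hqdef]; exact_mod_cast Fintype.card_pos
  have hT := translateSum_nonneg (quadric a) hg
  have hX : (Fintype.card (Fin d → F) : ℝ) = q ^ (2 * k : ℝ) := by
    rw [Fintype.card_fun, Fintype.card_fin, Nat.cast_pow, ← hqdef, hk, ← Real.rpow_natCast]
    congr 1
    push_cast
    ring
  have hVinv : ((quadric a).ncard : ℝ)⁻¹ ≤ 2 * q ^ (-r) := by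
    have hpow : q ^ (d - 1) = q ^ r := by
      rw [← Real.rpow_natCast]
      congr 1
      rw [hr, Nat.cast_sub (by omega), hk]
      push_cast
      ring
    rw [hpow] at hV
    rw [Real.rpow_neg hq.le, ← div_eq_mul_inv, inv_le_iff_one_le_mul₀, div_mul_eq_mul_div, le_div_iff₀ (by positivity)]
    · linarith
    · have : 0 < q ^ r := by positivity
      linarith
  have hSg : 0 ≤ ∑ x, g x ^ b := Finset.sum_nonneg fun x _ => Real.rpow_nonneg (hg x) _
  have hST : 0 ≤ ∑ x, translateSum (quadric a) g x ^ r :=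
    Finset.sum_nonneg fun x _ => Real.rpow_nonneg (hT x) _
  have hn : ∀ z : ℝ, ((q ^ (2 * k : ℝ))⁻¹) ^ z = q ^ (-(2 * k * z)) := fun z => by
    rw [← Real.rpow_neg hq.le, ← Real.rpow_mul hq.le, neg_mul]
  rw [hX, Real.mul_rpow (by positivity) hSg, Real.mul_rpow (by positivity)
    (Finset.sum_nonneg fun x _ => Real.rpow_nonneg (mean_nonneg hg x) _), hn, hn]
  simp only [mean]
  rw [Lp_const_mul hr0 (by positivity) hT]
  -- The powers of `q` come from the normalized measure, from `1/|V|` and from the endpoint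
  -- estimate; they match exactly at the vertex.
  have hexp : -(2 * k * (1 / r)) + -r + 1 = -(2 * k * (1 / b)) := by
    have : 1 / b = 1 / (k * r) + (r - 1) / r := by linarith
    rw [this, hr]
    rw [hr] at hr0
    have h3 := hr0.ne'
    field_simp
    ring
  calc q ^ (-(2 * k * (1 / r))) * (((quadric a).ncard : ℝ)⁻¹ *
        (∑ x, translateSum (quadric a) g x ^ r) ^ (1 / r))
      ≤ q ^ (-(2 * k * (1 / r))) * ((2 * q ^ (-r)) * (C * q * (∑ x, g x ^ b) ^ (1 / b))) := by
        gcongr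
    _ = 2 * C * (q ^ (-(2 * k * (1 / r))) * q ^ (-r) * q ^ (1 : ℝ)) *
          (∑ x, g x ^ b) ^ (1 / b) := by rw [Real.rpow_one]; ring
    _ = 2 * C * q ^ (-(2 * k * (1 / b))) * (∑ x, g x ^ b) ^ (1 / b) := by
        rw [← Real.rpow_add hq, ← Real.rpow_add hq, hexp]
    _ = _ := by rw [Real.coe_toNNReal _ (by positivity)]; ring

end VertexBounds

end QuadricAveraging

end

noncomputable section

namespace QuadricAveraging

/-! ### The whole pentagon from its vertices. -/

section Sufficiency

lemma IsAdmissible.two_ne_zero {d : ℕ} {F : Type*} [Field F] {a : Fin d → F}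
    (h : IsAdmissible a) : (2 : F) ≠ 0 :=
  Ring.two_ne_zero h.char_ne_two

/-- The pairs `(1/p, 1/r)` for which the averaging operators over all admissible quadrics are
uniformly bounded. -/
def boundedExponents (d : ℕ) : Set (ℝ × ℝ) :=
  {z | 0 ≤ z.1 ∧ 0 ≤ z.2 ∧ ∃ C : ℝ≥0, ∀ (F : Type u) [Field F] [Fintype F] (a : Fin d → F),
    IsAdmissible a →
      AveragingBound (quadric a) (ENNReal.ofReal z.1)⁻¹ (ENNReal.ofReal z.2)⁻¹ C}

lemma quadric_nonempty {d : ℕ} {F : Type*} [Field F] (a : Fin d → F) : (quadric a).Nonempty :=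
  ⟨0, zero_mem_quadric a⟩

lemma neg_mem_quadric {d : ℕ} {F : Type*} [Field F] (a x : Fin d → F) :
    -x ∈ quadric a ↔ x ∈ quadric a := by
  rw [mem_quadric, mem_quadric, diagForm_neg]

lemma convex_boundedExponents (d : ℕ) : Convex ℝ (boundedExponents.{u} d) := by
  rw [convex_iff_forall_pos]
  rintro ⟨x₀, y₀⟩ ⟨hx₀, hy₀, C₀, h₀⟩ ⟨x₁, y₁⟩ ⟨hx₁, hy₁, C₁, h₁⟩ s t hs ht hst
  simp only at hx₀ hy₀ hx₁ hy₁ h₀ h₁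
  refine ⟨by simp only [Prod.smul_mk, Prod.mk_add_mk, smul_eq_mul]; positivity,
    by simp only [Prod.smul_mk, Prod.mk_add_mk, smul_eq_mul]; positivity,
    max 1 (C₀ ^ s * C₁ ^ t), fun F _ _ a ha => ?_⟩
  simpa only [Prod.smul_mk, Prod.mk_add_mk, smul_eq_mul] using
    (h₀ F a ha).interpolate (quadric_nonempty a) hx₀ hy₀ hx₁ hy₁ hs ht hst (h₁ F a ha)

lemma exponentRegion_subset {k d : ℕ} (hk : d = k + k) (hk2 : 2 ≤ k) :
    exponentRegion d ⊆ boundedExponents.{u} d := by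
  have hkr : (2 : ℝ) ≤ k := by exact_mod_cast hk2
  have hd : (d : ℝ) = 2 * k := by rw [hk]; push_cast; ring
  obtain ⟨hb1, -, -, -⟩ := vertexExponent_spec hk2
  have hb0 : 0 < vertexExponent k := by linarith
  have hr0 : (0 : ℝ) < 2 * k - 1 := by linarith
  have hden : (0 : ℝ) < 2 * k ^ 2 - 2 * k + 1 := by nlinarith
  have hb : ((d : ℝ) ^ 2 - 2 * d + 2) / (d * (d - 1)) = (vertexExponent k)⁻¹ := by
    have : (2 * (k : ℝ)) ^ 2 - 2 * (2 * k) + 2 = 2 * (2 * k ^ 2 - 2 * k + 1) := by ring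
    rw [vertexExponent, inv_div, hd, this, mul_assoc, mul_div_mul_left _ _ (by norm_num)]
  have hr : 1 / ((d : ℝ) - 1) = (2 * k - 1 : ℝ)⁻¹ := by rw [hd, one_div]
  have hb' : ((d : ℝ) - 2) / (d * (d - 1)) = 1 - (vertexExponent k)⁻¹ := by
    have h1 : (d : ℝ) ≠ 0 := by rw [hd]; positivity
    have h2 : (d : ℝ) - 1 ≠ 0 := by rw [hd]; exact hr0.ne'
    rw [← hb]
    field_simp
    ring
  have hr' : ((d : ℝ) - 2) / (d - 1) = 1 - (2 * k - 1 : ℝ)⁻¹ := by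
    have h2 : (d : ℝ) - 1 ≠ 0 := by rw [hd]; exact hr0.ne'
    rw [← hr]
    field_simp
    ring
  have hbc : (vertexExponent k).HolderConjugate (1 - (vertexExponent k)⁻¹)⁻¹ :=
    Real.holderConjugate_iff.2 ⟨hb1, by rw [inv_inv]; ring⟩
  have hrc : (2 * k - 1 : ℝ).HolderConjugate (1 - (2 * k - 1 : ℝ)⁻¹)⁻¹ :=
    Real.holderConjugate_iff.2 ⟨by linarith, by rw [inv_inv]; ring⟩
  have hb'0 : 0 < 1 - (vertexExponent k)⁻¹ := inv_pos.1 hbc.symm.pos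
  have hr'0 : 0 < 1 - (2 * k - 1 : ℝ)⁻¹ := inv_pos.1 hrc.symm.pos
  obtain ⟨C, hC⟩ := exists_averagingBound_vertex.{u} hk hk2
  refine convexHull_min ?_ (convex_boundedExponents d)
  rw [hb, hr, hb', hr']
  rintro z (rfl | rfl | rfl | rfl | rfl)
  · refine ⟨le_rfl, le_rfl, 1, fun F _ _ a _ => ?_⟩
    simpa using averagingBound_top (quadric_nonempty a) ∞
  · refine ⟨le_rfl, zero_le_one, 1, fun F _ _ a _ => ?_⟩
    simpa using averagingBound_top (quadric_nonempty a) 1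
  · refine ⟨zero_le_one, zero_le_one, 1, fun F _ _ a _ => ?_⟩
    simpa using averagingBound_one (quadric_nonempty a) (neg_mem_quadric a)
  · refine ⟨by simp only; positivity, by simp only; positivity, C, fun F _ _ a ha => ?_⟩
    simp only
    rw [ENNReal.ofReal_inv_of_pos hb0, ENNReal.ofReal_inv_of_pos hr0, inv_inv, inv_inv]
    exact hC F a ha.two_ne_zero ha.coeff_ne_zero
  · refine ⟨hr'0.le, hb'0.le, C, fun F _ _ a ha => ?_⟩
    simp only
    rw [← ENNReal.ofReal_inv_of_pos hb'0, ← ENNReal.ofReal_inv_of_pos hr'0]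
    exact (hC F a ha.two_ne_zero ha.coeff_ne_zero).dual (neg_mem_quadric a) hbc hrc

end Sufficiency

/-! ### Test functions and the edges of the pentagon. -/

section Necessity

/-- Testing the averaging inequality on the indicator function of a set `E`. -/
lemma AveragingBound.test {d : ℕ} {F : Type*} [Field F] [Fintype F] {V : Set (Fin d → F)}
    {p r : ℝ≥0∞} (hp : 1 ≤ p) (hr : 1 ≤ r) {C : ℝ≥0} (h : AveragingBound V p r C)
    {W E : Set (Fin d → F)} (hW : W.Nonempty) (hE : E.Nonempty)
    (hWE : ∀ x ∈ W, ∀ y ∈ E, x - y ∈ V) :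
    (E.ncard : ℝ) / V.ncard * (W.ncard / (Fintype.card F : ℝ) ^ d) ^ (r⁻¹).toReal ≤
      C * (E.ncard / (Fintype.card F : ℝ) ^ d) ^ (p⁻¹).toReal := by
  classical
  let _ : MeasurableSpace (Fin d → F) := ⊤
  rw [averagingBound_iff] at h
  set g : (Fin d → F) → ℝ := E.indicator fun _ => 1 with hg
  have hg0 : ∀ x, 0 ≤ g x := Set.indicator_nonneg fun _ _ => zero_le_one
  set c : ℝ := (E.ncard : ℝ) / V.ncard with hc
  have hc0 : 0 ≤ c := by positivity
  have hmean : ∀ x, ‖W.indicator (fun _ => c) x‖ ≤ mean V g x := by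
    intro x
    by_cases hx : x ∈ W
    · rw [Set.indicator_of_mem hx, Real.norm_of_nonneg hc0, hc, mean, translateSum_eq,
        div_eq_inv_mul]
      gcongr
      rw [Set.ncard_eq_toFinset_card', ← nsmul_one, ← Finset.sum_const]
      calc ∑ y ∈ E.toFinset, (1 : ℝ)
          = ∑ y ∈ E.toFinset, (if x - y ∈ V then g y else 0) := by
            refine Finset.sum_congr rfl fun y hy => ?_
            have hy : y ∈ E := Set.mem_toFinset.1 hy
            rw [if_pos (hWE x hx y hy), hg, Set.indicator_of_mem hy]
        _ ≤ _ := Finset.sum_le_sum_of_subset_of_nonneg (Finset.subset_univ _) fun y _ _ => by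
            split_ifs
            · exact hg0 y
            · exact le_rfl
    · rw [Set.indicator_of_notMem hx, norm_zero]
      exact mean_nonneg hg0 x
  have hμ : ∀ S : Set (Fin d → F), normalizedCount (Fin d → F) S =
      ENNReal.ofReal (S.ncard / (Fintype.card F : ℝ) ^ d) := by
    intro S
    have hn : (0 : ℝ) < (Fintype.card F : ℝ) ^ d :=
      pow_pos (by exact_mod_cast Fintype.card_pos) _
    rw [normalizedCount_apply, div_eq_inv_mul, ENNReal.ofReal_mul (by positivity),
      ENNReal.ofReal_inv_of_pos hn, ENNReal.ofReal_natCast, Fintype.card_fun, Fintype.card_fin]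
    norm_cast
  have hμ0 : ∀ S : Set (Fin d → F), S.Nonempty → normalizedCount (Fin d → F) S ≠ 0 := by
    intro S hS
    rw [normalizedCount_apply]
    simp [(Set.ncard_pos (Set.toFinite S)).2 hS |>.ne']
  have h1 := (eLpNorm_mono_real (p := r) (μ := normalizedCount (Fin d → F)) hmean).trans
    (h g hg0)
  rw [eLpNorm_indicator_const' (by trivial) (hμ0 W hW) (by positivity), hg,
    eLpNorm_indicator_const' (by trivial) (hμ0 E hE) (by positivity), hμ, hμ,
    Real.enorm_eq_ofReal hc0, enorm_one, one_mul, one_div, one_div, ← ENNReal.toReal_inv,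
    ← ENNReal.toReal_inv, ENNReal.ofReal_rpow_of_nonneg (by positivity) (by positivity),
    ENNReal.ofReal_rpow_of_nonneg (by positivity) (by positivity),
    ← ENNReal.ofReal_mul hc0, ← ENNReal.ofReal_coe_nnreal (p := C),
    ← ENNReal.ofReal_mul C.coe_nonneg,
    ENNReal.ofReal_le_ofReal_iff (by positivity)] at h1
  exact h1

lemma exponent_nonpos_of_bounded {ι : Type*} {q : ι → ℝ} (hq : ∀ N : ℕ, ∃ i, (N : ℝ) ≤ q i)
    {e K : ℝ} (h : ∀ i, q i ^ e ≤ K) : e ≤ 0 := by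
  by_contra! he
  obtain ⟨N, hN⟩ := Filter.eventually_atTop.1
    ((tendsto_rpow_atTop he).eventually_gt_atTop K)
  obtain ⟨i, hi⟩ := hq ⌈N⌉₊
  exact absurd (h i) (not_le.2 (hN _ ((Nat.le_ceil N).trans hi)))

lemma exponent_le_of_bounded {ι : Type*} {q : ι → ℝ} (hq0 : ∀ i, 0 < q i)
    (hq : ∀ N : ℕ, ∃ i, (N : ℝ) ≤ q i) {e e' K : ℝ} (h : ∀ i, q i ^ e ≤ K * q i ^ e') :
    e ≤ e' := by
  refine sub_nonpos.1 (exponent_nonpos_of_bounded hq (K := K) fun i => ?_)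
  rw [Real.rpow_sub (hq0 i), div_le_iff₀ (Real.rpow_pos_of_pos (hq0 i) _)]
  exact h i

/-- Points between the lower boundary of the pentagon and the line `y = 1` lie in it. -/
lemma mem_exponentRegion {d : ℕ} (hd : 4 ≤ d) {x y : ℝ} (hx0 : 0 ≤ x) (hx1 : x ≤ 1)
    (hy1 : y ≤ 1) (h1 : x ≤ d * y) (h2 : d * (x - y) ≤ d - 2) (h3 : d * x ≤ d - 1 + y) :
    (x, y) ∈ exponentRegion d := by
  have hdr : (4 : ℝ) ≤ d := by exact_mod_cast hd
  have hd0 : (0 : ℝ) < d := by linarith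
  have hd1 : (0 : ℝ) < d - 1 := by linarith
  have hconv : Convex ℝ (exponentRegion d) := convex_convexHull ℝ _
  have hsub := subset_convexHull ℝ {((0 : ℝ), (0 : ℝ)), (0, 1), (1, 1),
    (((d : ℝ) ^ 2 - 2 * d + 2) / (d * (d - 1)), 1 / ((d : ℝ) - 1)),
    (((d : ℝ) - 2) / (d - 1), ((d : ℝ) - 2) / (d * (d - 1)))}
  have hseg : ∀ {u₀ v₀ u₁ v₁ w l : ℝ}, (u₀, v₀) ∈ exponentRegion d →
      (u₁, v₁) ∈ exponentRegion d → u₀ < u₁ → u₀ ≤ w → w ≤ u₁ →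
      (l - v₀) * (u₁ - u₀) = (v₁ - v₀) * (w - u₀) → (w, l) ∈ exponentRegion d := by
    intro u₀ v₀ u₁ v₁ w l m₀ m₁ h01 hw0 hw1 hl
    have hpos : 0 < u₁ - u₀ := by linarith
    have := hconv m₀ m₁ (a := (u₁ - w) / (u₁ - u₀)) (b := (w - u₀) / (u₁ - u₀))
      (div_nonneg (by linarith) hpos.le) (div_nonneg (by linarith) hpos.le)
      (by rw [← add_div, div_eq_one_iff_eq hpos.ne']; ring)
    convert this using 1
    simp only [Prod.smul_mk, Prod.mk_add_mk, smul_eq_mul, Prod.mk.injEq]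
    constructor
    · field_simp; ring
    · field_simp; linear_combination hl
  set x₁ : ℝ := ((d : ℝ) ^ 2 - 2 * d + 2) / (d * (d - 1)) with hx₁
  set x₂ : ℝ := ((d : ℝ) - 2) / (d - 1) with hx₂
  have m0 : ((0 : ℝ), (0 : ℝ)) ∈ exponentRegion d := hsub (by simp)
  have m01 : ((0 : ℝ), (1 : ℝ)) ∈ exponentRegion d := hsub (by simp)
  have m11 : ((1 : ℝ), (1 : ℝ)) ∈ exponentRegion d := hsub (by simp)
  have m1 : (x₁, 1 / ((d : ℝ) - 1)) ∈ exponentRegion d := hsub (by simp)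
  have m2 : (x₂, ((d : ℝ) - 2) / (d * (d - 1))) ∈ exponentRegion d := hsub (by simp)
  have hx₂0 : 0 < x₂ := div_pos (by linarith) hd1
  have e1 : x₁ * (d * (d - 1)) = (d : ℝ) ^ 2 - 2 * d + 2 := by
    rw [hx₁, div_mul_cancel₀ _ (by positivity)]
  have e2 : x₂ * (d - 1) = (d : ℝ) - 2 := by rw [hx₂, div_mul_cancel₀ _ hd1.ne']
  have hx₁1 : x₁ < 1 := by rw [hx₁, div_lt_one (by positivity)]; nlinarith
  have hx₂₁ : x₂ < x₁ := by
    have h : 0 < (d : ℝ) * (d - 1) := by positivity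
    have : x₂ * (d * (d - 1)) < x₁ * (d * (d - 1)) := by
      rw [e1]
      calc x₂ * (d * (d - 1)) = d * (x₂ * (d - 1)) := by ring
        _ = d * (d - 2) := by rw [e2]
        _ < _ := by nlinarith
    exact lt_of_mul_lt_mul_right this h.le
  have htop : (x, (1 : ℝ)) ∈ exponentRegion d :=
    hseg m01 m11 zero_lt_one hx0 hx1 (by ring)
  -- The region contains every vertical segment up to the edge `y = 1`, so a boundary point below
  -- `(x, y)` suffices. The cases that follow take it on one of the three lower edges.
  have hvert : ∀ l, l ≤ y → (x, l) ∈ exponentRegion d → (x, y) ∈ exponentRegion d := by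
    intro l hl m
    rcases hl.eq_or_lt with rfl | hl
    · exact m
    have hpos : 0 < 1 - l := by linarith
    have := hconv m htop (a := (1 - y) / (1 - l)) (b := (y - l) / (1 - l))
      (div_nonneg (by linarith) hpos.le) (div_nonneg (by linarith) hpos.le)
      (by rw [← add_div, div_eq_one_iff_eq hpos.ne']; ring)
    convert this using 1
    simp only [Prod.smul_mk, Prod.mk_add_mk, smul_eq_mul, Prod.mk.injEq]
    constructor <;> field_simp <;> ring
  rcases le_total x x₂ with hx | hx
  · refine hvert (x / d) (by rw [div_le_iff₀ hd0]; linarith) (hseg m0 m2 hx₂0 hx0 hx ?_)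
    rw [hx₂]
    field_simp
    ring
  rcases le_total x x₁ with hx' | hx'
  · refine hvert (x - (d - 2) / d) ?_ (hseg m2 m1 hx₂₁ hx hx' ?_)
    · rw [sub_le_iff_le_add, ← sub_le_iff_le_add', le_div_iff₀ hd0]
      linarith
    · rw [hx₂, hx₁]
      field_simp
      ring
  · refine hvert (d * x - (d - 1)) (by linarith) (hseg m1 m11 hx₁1 hx' hx1 ?_)
    rw [hx₁]
    field_simp
    ring

lemma ncard_submodule {d : ℕ} {F : Type*} [Field F] [Fintype F]
    (H : Submodule F (Fin d → F)) :
    (H : Set (Fin d → F)).ncard = Fintype.card F ^ Module.finrank F H := by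
  have h := Module.natCard_eq_pow_finrank (K := F) (V := H)
  rw [Nat.card_eq_fintype_card (α := F)] at h
  rw [← h]
  rfl

/-- Uniform bounds along a family with unbounded field size force `(1/p, 1/r)` into the
pentagon. -/
lemma mem_exponentRegion_of_bounded {k d : ℕ} (hk : d = k + k) (hk2 : 2 ≤ k) {p r : ℝ≥0∞}
    (hp : 1 ≤ p) (hr : 1 ≤ r) {ι : Type*} {F : ι → Type*} [∀ i, Field (F i)]
    [∀ i, Fintype (F i)] {a : ∀ i, Fin d → F i} (ha : ∀ i, IsAdmissible (a i))
    (hF : ∀ N : ℕ, ∃ i, N ≤ Fintype.card (F i)) {C : ℝ≥0}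
    (h : ∀ i, AveragingBound (quadric (a i)) p r C) :
    ((p⁻¹).toReal, (r⁻¹).toReal) ∈ exponentRegion d := by
  have hd : (d : ℝ) = 2 * k := by rw [hk]; push_cast; ring
  have hkr : (2 : ℝ) ≤ k := by exact_mod_cast hk2
  set x := (p⁻¹).toReal with hx
  set y := (r⁻¹).toReal with hy
  have hinv : ∀ s : ℝ≥0∞, 1 ≤ s → (s⁻¹).toReal ≤ 1 := fun s hs =>
    ENNReal.toReal_le_of_le_ofReal zero_le_one (by simpa using hs)
  have hx0 : 0 ≤ x := ENNReal.toReal_nonneg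
  have hy0 : 0 ≤ y := ENNReal.toReal_nonneg
  have hx1 : x ≤ 1 := hinv p hp
  have hy1 : y ≤ 1 := hinv r hr
  set q : ι → ℝ := fun i => (Fintype.card (F i) : ℝ) with hq
  have hq0 : ∀ i, 0 < q i := fun i => by
    exact Nat.cast_pos.2 Fintype.card_pos
  have hqN : ∀ N : ℕ, ∃ i, (N : ℝ) ≤ q i := fun N => by
    obtain ⟨i, hi⟩ := hF N
    exact ⟨i, Nat.cast_le.2 hi⟩
  have hVl : ∀ i, q i ^ (d - 1 : ℝ) ≤ 2 * (quadric (a i)).ncard ∧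
      ((quadric (a i)).ncard : ℝ) ≤ 2 * q i ^ (d - 1 : ℝ) := by
    intro i
    have e : q i ^ (d - 1 : ℝ) = (Fintype.card (F i) : ℝ) ^ (d - 1) := by
      rw [← Real.rpow_natCast, Nat.cast_sub (by omega), Nat.cast_one]
    rw [e]
    exact ncard_quadric_bounds (a i) (ha i).two_ne_zero (ha i).coeff_ne_zero hk hk2
  have hV0 : ∀ i, (0 : ℝ) < (quadric (a i)).ncard := fun i => by
    exact_mod_cast (Set.ncard_pos (Set.toFinite _)).2 (quadric_nonempty (a i))
  have htest := fun i (W E : Set (Fin d → F i)) (hW : W.Nonempty) (hE : E.Nonempty) hWE =>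
    (h i).test hp hr (W := W) (E := E) hW hE hWE
  have hpow : ∀ i, (Fintype.card (F i) : ℝ) ^ d = q i ^ (d : ℝ) := fun i =>
    (Real.rpow_natCast _ _).symm
  have hhalf : ∀ {z : ℝ}, 0 ≤ z → z ≤ 1 → (1 / 2 : ℝ) ≤ (1 / 2 : ℝ) ^ z := fun {z} _ h1 => by
    calc (1 / 2 : ℝ) = (1 / 2 : ℝ) ^ (1 : ℝ) := (Real.rpow_one _).symm
      _ ≤ _ := Real.rpow_le_rpow_of_exponent_ge (by norm_num) (by norm_num) h1
  have htwo : (2 : ℝ) ^ x ≤ 2 := by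
    calc (2 : ℝ) ^ x ≤ (2 : ℝ) ^ (1 : ℝ) :=
          Real.rpow_le_rpow_of_exponent_le (by norm_num) hx1
      _ = _ := Real.rpow_one _
  have hVinv : ∀ i, 1 / 2 * q i ^ (-(d - 1 : ℝ)) ≤ 1 / ((quadric (a i)).ncard : ℝ) := by
    intro i
    rw [Real.rpow_neg (hq0 i).le, ← one_div, one_div_mul_one_div]
    exact one_div_le_one_div_of_le (hV0 i) (hVl i).2
  refine mem_exponentRegion (by omega) hx0 hx1 hy1 ?_ ?_ ?_
  · -- the indicator function of the quadric
    have h1 : ∀ i, q i ^ (-(d * y)) ≤ (2 * C) * q i ^ (-x) := by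
      intro i
      have h2 := htest i {0} (quadric (a i)) (Set.singleton_nonempty _) (quadric_nonempty _)
        (by
          rintro _ rfl z hz
          rw [zero_sub]
          exact (neg_mem_quadric _ _).2 hz)
      rw [div_self (hV0 i).ne', one_mul, Set.ncard_singleton, hpow, Nat.cast_one, one_div,
        ← Real.rpow_neg (hq0 i).le, ← Real.rpow_mul (hq0 i).le] at h2
      calc q i ^ (-(d * y)) = q i ^ (-d * y) := by rw [neg_mul]
        _ ≤ _ := h2
        _ ≤ C * (2 * q i ^ (-1 : ℝ)) ^ x := by
            gcongr
            rw [div_le_iff₀ (Real.rpow_pos_of_pos (hq0 i) _), mul_assoc,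
              ← Real.rpow_add (hq0 i), show (-1 + d : ℝ) = d - 1 by ring]
            exact (hVl i).2
        _ = C * (2 ^ x * q i ^ (-x)) := by
            have := Real.rpow_nonneg (hq0 i).le (-1 : ℝ)
            rw [Real.mul_rpow (by norm_num) this, ← Real.rpow_mul (hq0 i).le, neg_one_mul]
        _ ≤ C * (2 * q i ^ (-x)) := by
            have := Real.rpow_nonneg (hq0 i).le (-x)
            gcongr
        _ = _ := by ring
    have := exponent_le_of_bounded hq0 hqN h1
    linarith
  · -- the indicator function of a maximal isotropic subspace
    have h1 : ∀ i, q i ^ (k - (d - 1) - k * y : ℝ) ≤ (2 * C) * q i ^ (-(k * x)) := by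
      intro i
      obtain ⟨H, hH, hHV⟩ := (ha i).exists_subspace
      have hHk : ((H : Set (Fin d → F i)).ncard : ℝ) = q i ^ (k : ℝ) := by
        rw [ncard_submodule, hH, Real.rpow_natCast, Nat.cast_pow, hk]
        congr 1
        omega
      have h2 := htest i H H ⟨0, H.zero_mem⟩ ⟨0, H.zero_mem⟩
        (fun u hu v hv => hHV (H.sub_mem hu hv))
      have e : q i ^ (k : ℝ) / q i ^ (d : ℝ) = q i ^ (-k : ℝ) := by
        rw [← Real.rpow_sub (hq0 i), hd]
        congr 1
        ring
      rw [hHk, hpow, e, ← Real.rpow_mul (hq0 i).le, ← Real.rpow_mul (hq0 i).le] at h2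
      have h3 := Real.rpow_nonneg (hq0 i).le (k : ℝ)
      have h4 := Real.rpow_nonneg (hq0 i).le (-k * y)
      calc q i ^ (k - (d - 1) - k * y : ℝ)
          = 2 * (q i ^ (k : ℝ) * (1 / 2 * q i ^ (-(d - 1 : ℝ))) * q i ^ (-k * y)) := by
            rw [show (k - (d - 1) - k * y : ℝ) = k + -(d - 1) + -k * y by ring,
              Real.rpow_add (hq0 i), Real.rpow_add (hq0 i)]
            ring
        _ ≤ 2 * (q i ^ (k : ℝ) * (1 / (quadric (a i)).ncard) * q i ^ (-k * y)) := by
            gcongr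
            exact hVinv i
        _ ≤ 2 * (C * q i ^ (-k * x)) := by
            rw [mul_one_div]
            gcongr
        _ = _ := by rw [neg_mul]; ring
    -- Divided by `k = d/2`, the comparison of exponents reads `x - y ≤ (d - 2)/d`.
    have := exponent_le_of_bounded hq0 hqN h1
    rw [hd] at this ⊢
    linarith
  · -- the indicator function of the origin
    have h1 : ∀ i, q i ^ (-(d - 1) - y : ℝ) ≤ (4 * C) * q i ^ (-(d * x)) := by
      intro i
      have h2 := htest i (quadric (a i)) {0} (quadric_nonempty _) (Set.singleton_nonempty _)
        (by
          rintro z hz _ rfl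
          rwa [sub_zero])
      rw [Set.ncard_singleton, hpow, Nat.cast_one, one_div (q i ^ (d : ℝ)),
        ← Real.rpow_neg (hq0 i).le, ← Real.rpow_mul (hq0 i).le] at h2
      have h3 := Real.rpow_nonneg (hq0 i).le (-y)
      have h5 := Real.rpow_nonneg (hq0 i).le (-1)
      have h4 : 1 / 2 * q i ^ (-y) ≤ ((quadric (a i)).ncard / q i ^ (d : ℝ)) ^ y := by
        calc 1 / 2 * q i ^ (-y) ≤ (1 / 2) ^ y * q i ^ (-y) := by
              gcongr
              exact hhalf hy0 hy1
          _ = (1 / 2 * q i ^ (-1 : ℝ)) ^ y := by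
              rw [Real.mul_rpow (by norm_num) h5, ← Real.rpow_mul (hq0 i).le, neg_one_mul]
          _ ≤ _ := by
              gcongr
              rw [le_div_iff₀ (Real.rpow_pos_of_pos (hq0 i) _), mul_assoc,
                ← Real.rpow_add (hq0 i), show (-1 + d : ℝ) = d - 1 by ring]
              linarith [(hVl i).1]
      calc q i ^ (-(d - 1) - y : ℝ)
          = 4 * ((1 / 2 * q i ^ (-(d - 1 : ℝ))) * (1 / 2 * q i ^ (-y))) := by
            rw [sub_eq_add_neg, Real.rpow_add (hq0 i)]
            ring
        _ ≤ 4 * (1 / (quadric (a i)).ncard * ((quadric (a i)).ncard / q i ^ (d : ℝ)) ^ y) := by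
            gcongr
            exact hVinv i
        _ ≤ 4 * (C * q i ^ (-d * x)) := by gcongr
        _ = _ := by rw [neg_mul]; ring
    have := exponent_le_of_bounded hq0 hqN h1
    linarith

end Necessity

/-! ### Admissible quadrics over large prime fields. -/

section Existence

/-- A sum of `k` squares minus another such sum vanishes on the diagonal, which has dimension `k`.
-/
lemma isAdmissible_append {F : Type*} [Field F] (h : ringChar F ≠ 2) (k : ℕ) :
    IsAdmissible (Fin.append (fun _ : Fin k => (1 : F)) (fun _ : Fin k => -1)) where
  char_ne_two := h
  coeff_ne_zero j := by
    refine Fin.addCases (fun i => ?_) (fun i => ?_) j <;> simp [-Fin.natAdd_eq_addNat]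
  exists_subspace := by
    let f : (Fin k → F) →ₗ[F] (Fin (k + k) → F) :=
      { toFun := fun y => Fin.append y y
        map_add' := fun y z => by
          ext j
          refine Fin.addCases (fun i => ?_) (fun i => ?_) j <;> simp [-Fin.natAdd_eq_addNat]
        map_smul' := fun c y => by
          ext j
          refine Fin.addCases (fun i => ?_) (fun i => ?_) j <;> simp [-Fin.natAdd_eq_addNat] }
    have hf : Function.Injective f := fun y z hyz => by
      ext i
      have := congrFun hyz (Fin.castAdd k i)
      simpa [f] using this
    refine ⟨LinearMap.range f, ?_, ?_⟩
    · rw [LinearMap.finrank_range_of_inj hf, Module.finrank_fin_fun]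
      omega
    · rintro _ ⟨y, rfl⟩
      simp [quadric, f, Fin.sum_univ_add, -Fin.natAdd_eq_addNat]

/-- There are admissible quadrics over arbitrarily large finite fields. -/
lemma exists_isAdmissible_family (k : ℕ) : ∃ (F : ℕ → Type u) (_ : ∀ i, Field (F i))
    (_ : ∀ i, Fintype (F i)) (a : ∀ i, Fin (k + k) → F i), (∀ i, IsAdmissible (a i)) ∧
      ∀ N : ℕ, ∃ i, N ≤ Fintype.card (F i) := by
  -- The shift by `3` excludes characteristic two.
  have hp : ∀ N : ℕ, ∃ p, N + 3 ≤ p ∧ p.Prime := fun N => Nat.exists_infinite_primes (N + 3)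
  choose p hpN hp using hp
  have : ∀ i, Fact (p i).Prime := fun i => ⟨hp i⟩
  refine ⟨fun i => ULift.{u} (ZMod (p i)), fun i => inferInstance, fun i => inferInstance,
    fun i => Fin.append (fun _ => 1) (fun _ => -1), fun i => isAdmissible_append ?_ k,
    fun N => ⟨N, ?_⟩⟩
  · rw [ringChar.eq (ULift.{u} (ZMod (p i))) (p i)]
    have := hpN i
    omega
  · rw [Fintype.card_ulift, ZMod.card]
    have := hpN N
    omega

end Existence

end QuadricAveraging

end

namespace QuadricAveraging

/-- The uniform bound at a point of the pentagon. -/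
lemma exists_averagingBound {k d : ℕ} (hk : d = k + k) (hk2 : 2 ≤ k) {p r : ℝ≥0∞}
    (hp : 1 ≤ p) (hr : 1 ≤ r) (h : ((p⁻¹).toReal, (r⁻¹).toReal) ∈ exponentRegion d) :
    ∃ C : ℝ≥0, ∀ (F : Type u) [Field F] [Fintype F] (a : Fin d → F),
      IsAdmissible a → AveragingBound (quadric a) p r C := by
  obtain ⟨-, -, C, hC⟩ := exponentRegion_subset.{u} hk hk2 h
  have hinv : ∀ s : ℝ≥0∞, 1 ≤ s → (ENNReal.ofReal (s⁻¹).toReal)⁻¹ = s := fun s hs => by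
    rw [ENNReal.ofReal_toReal (ENNReal.inv_ne_top.2 (zero_lt_one.trans_le hs).ne'), inv_inv]
  simp only [hinv p hp, hinv r hr] at hC
  exact ⟨C, hC⟩

end QuadricAveraging

theorem theorem1p1 (d : ℕ) (hd : 4 ≤ d) (heven : Even d)
    (p r : ℝ≥0∞) (hp : 1 ≤ p) (hr : 1 ≤ r) :
    -- one constant for all finite fields and all admissible surfaces
    ((∃ C : ℝ≥0, ∀ (F : Type u) [Field F] [Fintype F] (a : Fin d → F),
        QuadricAveraging.IsAdmissible a →
          QuadricAveraging.AveragingBound (QuadricAveraging.quadric a) p r C) ↔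
      ((p⁻¹).toReal, (r⁻¹).toReal) ∈ QuadricAveraging.exponentRegion d) ∧
    -- the same along any given family of admissible surfaces with unbounded field size
    (∀ (ι : Type v) (F : ι → Type u) [∀ i, Field (F i)] [∀ i, Fintype (F i)]
        (a : ∀ i, Fin d → F i),
        (∀ i, QuadricAveraging.IsAdmissible (a i)) →
        (∀ N : ℕ, ∃ i, N ≤ Fintype.card (F i)) →
        ((∃ C : ℝ≥0, ∀ i,
            QuadricAveraging.AveragingBound (QuadricAveraging.quadric (a i)) p r C) ↔
          ((p⁻¹).toReal, (r⁻¹).toReal) ∈ QuadricAveraging.exponentRegion d)) := by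
  obtain ⟨k, hk⟩ := heven
  have hk2 : 2 ≤ k := by omega
  refine ⟨⟨?_, QuadricAveraging.exists_averagingBound hk hk2 hp hr⟩, ?_⟩
  · rintro ⟨C, hC⟩
    subst hk
    obtain ⟨F, _, _, a, ha, hF⟩ := QuadricAveraging.exists_isAdmissible_family.{u} k
    exact QuadricAveraging.mem_exponentRegion_of_bounded rfl hk2 hp hr ha hF
      fun i => hC (F i) (a i) (ha i)
  · intro ι F _ _ a ha hF
    constructor
    · rintro ⟨C, hC⟩
      exact QuadricAveraging.mem_exponentRegion_of_bounded hk hk2 hp hr ha hF hC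
    · intro h
      obtain ⟨C, hC⟩ := QuadricAveraging.exists_averagingBound.{u} hk hk2 hp hr h
      exact ⟨C, fun i => hC (F i) (a i) (ha i)⟩
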